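/- Notation. $C(a)$ and $C(a|b)$ denote plain and conditional Kolmogorov complexity (with respect to a fixed optimal description method; $C(a)$ is the complexity given the empty string), and the same notation is used for codes of pairs of strings. Put $I(a:b)=C(b)-C(b|a)$, $I(a:b|e)=C(b|e)-C(b|a,e)$ and $I(a:b:e)=I(a:b)-I(a:b|e)$. Setting. Let $q$ and $d\ge 1$ be natural numbers, $n=\log_2 q$, and let $G=(L,R;E)$ be a finite bipartite graph, whose vertices are bit strings, with $|L|=q^2$, $|R|=q^{d+1}$, every vertex of $L$ having degree $D_L=q^d$ and every vertex of $R$ having degree $D_R=q$. Assume that $G$ is given explicitly: a fixed algorithm $A$ (one for all graphs considered), on input $\lfloor n\rfloor$ and $d$ (so on input $n$ and $d$ if $q=2^n$), prints the complete lists of the vertices of $L$, of the vertices of $R$, and of the edges of $G$. Assume that $G$ is a good spectral bipartite expander: the second largest eigenvalue (with multiplicity) of its adjacency matrix satisfies $\lambda_2\le\sqrt{\max\{D_L,D_R\}}$. For a natural number $m$ let $\bar G=(\bar L,\bar R;\bar E)$ be the $m$-private randomness amplification of $G$: $\bar L=L\times\{0,1\}^m$, $\bar R=R\times\{0,1\}^m$,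 and $(\langle x,r_x\rangle,\langle y,r_y\rangle)\in\bar E$ if and only if $(x,y)\in E$. For $\bar x=\langle x,r_x\rangle$ write $|\bar x|=|x|+|r_x|$ (total length of the strings), and similarly for $\bar y$. An edge $(\bar x,\bar y)\in\bar E$ is typical with precision constant $c$ if each of the equalities \[ C(\bar x)=2n+m,\qquad C(\bar y)=(d+1)n+m,\qquad C(\bar x,\bar y)=(d+2)n+2m \] holds up to an error of absolute value at most $c\log_2(|\bar x|+|\bar y|+2)$. Theorem 2. For every optimal description method, every algorithm $A$ and every constant $c$ there is a constant $c'$ such that the following holds for all $q$, $d\ge1$, $m$, all $G$ as above given by $A$, every edge $(\bar x,\bar y)$ of $\bar G$ that is typical with precision constant $c$, and every bit string $w$. Let $N=|\bar x|+|\bar y|+|w|$. If $|I(w:\bar y|\bar x)|\le c\log_2(N+2)$, then \[ I(w:\bar x:\bar y)\le c'\log_2(N+2)\qquad\text{or}\qquad I(w:\bar x|\bar y)+I(w:\bar y|\bar x)\ge n-c'\log_2(N+2). \] -/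

import Mathlib

/-! ### Kolmogorov complexity -/

/-- `U` is an optimal description method: `U (p, b)` is the output of the program `p` (a bit string)
on the condition `b`; `U` is partial computable, and it simulates every other partial computable
method at the price of a constant increase of the length of the programs.
Constructive objects (bit strings, pairs of bit strings, ...) are given to and
produced by `U` through their standard computable codes `Encodable.encode`. -/
def IsOptimal (U : List Bool × ℕ →. ℕ) : Prop :=
  Partrec U ∧ ∀ V : List Bool × ℕ →. ℕ, Partrec V →
    ∃ c : ℕ, ∀ (p : List Bool) (a b : ℕ), a ∈ V (p, b) →
      ∃ p' : List Bool, p'.length ≤ p.length + c ∧ a ∈ U (p', b)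

/-- The conditional Kolmogorov complexity `C(a | b)`: the length of a shortest program that
outputs `a` on the condition `b`. -/
noncomputable def condC (U : List Bool × ℕ →. ℕ) {α β : Type} [Primcodable α] [Primcodable β]
    (a : α) (b : β) : ℕ :=
  sInf {l : ℕ | ∃ p : List Bool, p.length = l ∧ Encodable.encode a ∈ U (p, Encodable.encode b)}

/-- The Kolmogorov complexity `C(a)`, where the condition is the empty string. -/
noncomputable def plainC (U : List Bool × ℕ →. ℕ) {α : Type} [Primcodable α] (a : α) : ℕ :=
  condC U a ([] : List Bool)

/-- `I(a : b) = C(b) - C(b | a)`. -/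
noncomputable def mutualInfo (U : List Bool × ℕ →. ℕ) {α β : Type} [Primcodable α] [Primcodable β]
    (a : α) (b : β) : ℝ :=
  (plainC U b : ℝ) - (condC U b a : ℝ)

/-- `I(a : b | e) = C(b | e) - C(b | a, e)`. -/
noncomputable def condMutualInfo (U : List Bool × ℕ →. ℕ) {α β γ : Type} [Primcodable α]
    [Primcodable β] [Primcodable γ] (a : α) (b : β) (e : γ) : ℝ :=
  (condC U b e : ℝ) - (condC U b (a, e) : ℝ)

/-- `I(a : b : e) = I(a : b) - I(a : b | e)`. -/
noncomputable def tripleInfo (U : List Bool × ℕ →. ℕ) {α β γ : Type} [Primcodable α]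
    [Primcodable β] [Primcodable γ] (a : α) (b : β) (e : γ) : ℝ :=
  mutualInfo U a b - condMutualInfo U a b e

/-- The term `log N` of the relations "up to `O(log N)`", where `N` is a sum of lengths of strings;
`+ 2` only matters for `N ≤ 1`. -/
noncomputable def logTerm (N : ℕ) : ℝ := Real.logb 2 ((N : ℝ) + 2)

/-! ### Bipartite graphs -/

/-- A finite bipartite graph `(L, R; E)`. The two parts are kept apart as the left and the right
part, even if `L` and `R` share elements as sets. -/
structure BipGraph (α β : Type) where
  L : Finset α
  R : Finset β
  E : Finset (α × β)
  E_subset : E ⊆ L ×ˢ R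

namespace BipGraph

variable {α β : Type} [DecidableEq α] [DecidableEq β]

/-- Every vertex of `L` has degree `DL` and every vertex of `R` has degree `DR`. -/
def IsBiregular (G : BipGraph α β) (DL DR : ℕ) : Prop :=
  (∀ x ∈ G.L, (G.R.filter fun y => (x, y) ∈ G.E).card = DL) ∧
  (∀ y ∈ G.R, (G.L.filter fun x => (x, y) ∈ G.E).card = DR)

/-- The parameters `|L| = q ^ 2`, `|R| = q ^ (d + 1)`, degrees `q ^ d` on the left and `q` on the
right. -/
def HasStandardParameters (G : BipGraph α β) (q d : ℕ) : Prop :=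
  G.L.card = q ^ 2 ∧ G.R.card = q ^ (d + 1) ∧ G.IsBiregular (q ^ d) q

/-- The biadjacency matrix. -/
def biadj (G : BipGraph α β) : Matrix G.L G.R ℝ :=
  Matrix.of fun x y => if ((x : α), (y : β)) ∈ G.E then 1 else 0

/-- The adjacency matrix, on the disjoint union of `L` and `R`. -/
def adj (G : BipGraph α β) : Matrix (G.L ⊕ G.R) (G.L ⊕ G.R) ℝ :=
  Matrix.fromBlocks 0 G.biadj G.biadj.transpose 0

theorem adj_isHermitian (G : BipGraph α β) : G.adj.IsHermitian := by
  rw [Matrix.IsHermitian, Matrix.conjTranspose_eq_transpose_of_trivial, adj,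
    Matrix.fromBlocks_transpose]
  simp

/-- The second largest eigenvalue (counted with multiplicity) of the adjacency matrix; the value `0`
for graphs with fewer than two vertices plays no role. -/
noncomputable def secondEigenvalue (G : BipGraph α β) : ℝ :=
  if h : 1 < Fintype.card (G.L ⊕ G.R) then G.adj_isHermitian.eigenvalues₀ ⟨1, h⟩ else 0

/-- A good spectral bipartite expander with degrees `DL`, `DR`. -/
def IsGoodSpectralExpander (G : BipGraph α β) (DL DR : ℕ) : Prop :=
  G.IsBiregular DL DR ∧ G.secondEigenvalue ≤ Real.sqrt (max (DL : ℝ) (DR : ℝ))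

/-- The set `{0,1}^m` of all bit strings of length `m`. -/
def bitStrings (m : ℕ) : Finset (List Bool) :=
  (Finset.univ : Finset (Fin m → Bool)).image List.ofFn

/-- The `m`-private randomness amplification of `G`. -/
def amplify (G : BipGraph α β) (m : ℕ) : BipGraph (α × List Bool) (β × List Bool) where
  L := G.L ×ˢ bitStrings m
  R := G.R ×ˢ bitStrings m
  E := ((G.L ×ˢ bitStrings m) ×ˢ (G.R ×ˢ bitStrings m)).filter fun e => (e.1.1, e.2.1) ∈ G.E
  E_subset := Finset.filter_subset _ _

/-- The algorithm `A`, given the numbers `k` and `d`, stops and outputs the complete lists of the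
left vertices, the right vertices and the edges of `G` (the vertices being bit strings). -/
def IsComputedBy (G : BipGraph (List Bool) (List Bool))
    (A : ℕ × ℕ →. List (List Bool) × List (List Bool) × List (List Bool × List Bool))
    (k d : ℕ) : Prop :=
  ∃ l ∈ A (k, d), l.1.toFinset = G.L ∧ l.2.1.toFinset = G.R ∧ l.2.2.toFinset = G.E

end BipGraph

/-- The length of a vertex `⟨x, r⟩` of an amplified graph. -/
def vertexLength (v : List Bool × List Bool) : ℕ := v.1.length + v.2.length

/-- The complexity profile of a typical edge `(x, y)` of the `m`-private randomness amplification
of a graph with parameters `q`, `d` holds with the precision `c * log N`, `N = |x| + |y|`: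
`C(x) ≈ 2n + m`, `C(y) ≈ (d+1)n + m`, `C(x,y) ≈ (d+2)n + 2m` with `n = log q`. -/
def IsTypicalPair (U : List Bool × ℕ →. ℕ) (c : ℝ) (q d m : ℕ)
    (x y : List Bool × List Bool) : Prop :=
  |(plainC U x : ℝ) - (2 * Real.logb 2 q + m)|
      ≤ c * logTerm (vertexLength x + vertexLength y) ∧
  |(plainC U y : ℝ) - (((d : ℝ) + 1) * Real.logb 2 q + m)|
      ≤ c * logTerm (vertexLength x + vertexLength y) ∧
  |(plainC U (x, y) : ℝ) - (((d : ℝ) + 2) * Real.logb 2 q + 2 * m)|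
      ≤ c * logTerm (vertexLength x + vertexLength y)

/-! ### The expander mixing lemma -/

/-! Put `a = C(x|w)` and `b = C(y|w)`, and let `S`, `T` be the sets of pairs of strings whose
complexity given `w` is at most `a`, respectively `b`. They have at most `2^(a+1)` and `2^(b+1)`
elements. The edge `(x, y)` is one of the edges of the amplified graph between `S` and `T`, and
these can be enumerated from `w` and `O(log N)` further bits. Hence `C(x,y|w)` is at most the
logarithm of their number (`exists_condC_le_of_enumeration`). The expander mixing lemma bounds this
number by `|S||T|/q + 2^m √(q^d |S||T|)` (`card_amplify_edges_le`). Up to `O(log N)` this gives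
(`exists_condC_edge_le_max`) `C(x,y|w) ≤ max(a + b - n, m + dn/2 + (a+b)/2)`.

If the first term is the larger one, symmetry of information (`exists_condC_add_le`) gives `C(x|w,y)
≤ C(x,y|w) - b ≤ a - n`. Typicality gives `C(x) - C(x|y) ≤ n`, so the triple information is at most
`O(log N)`.

If the second term is the larger one, both `a + C(y|w,x)` and `b + C(x|w,y)` are at most `C(x,y|w)`.
Adding the two cancels `a + b` and leaves `C(y|w,x) + C(x|w,y) ≤ dn + 2m`. By typicality `C(y|x) +
C(x|y) ≥ (d+1)n + 2m`, and the gap between the two sums is the required `n`. -/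

open Matrix in
-- The strict gap makes `u` a multiple of a single basis eigenvector, the top one. A vector
-- orthogonal to `u` then only sees the remaining eigenvalues. This avoids identifying the largest
-- eigenvalue with `μ` in advance.
theorem Matrix.IsHermitian.dotProduct_mulVec_le_of_dotProduct_eq_zero {n : Type*} [Fintype n]
    [DecidableEq n] {A : Matrix n n ℝ} (hA : A.IsHermitian) (h : 1 < Fintype.card n)
    {u v : n → ℝ} {μ : ℝ} (hu : A *ᵥ u = μ • u) (hu0 : u ≠ 0)
    (hμ : hA.eigenvalues₀ ⟨1, h⟩ < μ) (huv : u ⬝ᵥ v = 0) :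
    v ⬝ᵥ A *ᵥ v ≤ hA.eigenvalues₀ ⟨1, h⟩ * (v ⬝ᵥ v) := by
  set e : n → n → ℝ := fun i => ⇑(hA.eigenvectorBasis i) with he
  have parseval : ∀ x y : n → ℝ, x ⬝ᵥ y = ∑ i, (e i ⬝ᵥ x) * (e i ⬝ᵥ y) := by
    intro x y
    have := hA.eigenvectorBasis.sum_inner_mul_inner (WithLp.toLp 2 x) (WithLp.toLp 2 y)
    simp only [EuclideanSpace.inner_eq_star_dotProduct, star_trivial] at this
    rw [dotProduct_comm, ← this]
    exact Finset.sum_congr rfl fun i _ => by rw [dotProduct_comm y]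
  have coeff : ∀ (i : n) (x : n → ℝ), e i ⬝ᵥ A *ᵥ x = hA.eigenvalues i * (e i ⬝ᵥ x) := by
    intro i x
    have hT : Aᵀ = A := by
      rw [← Matrix.conjTranspose_eq_transpose_of_trivial]; exact hA
    rw [dotProduct_mulVec, ← mulVec_transpose, hT, he, hA.mulVec_eigenvectorBasis, smul_dotProduct,
      smul_eq_mul]
  -- `eigenvalues` is the decreasing family `eigenvalues₀` read through `s.symm`, so `i₀` carries
  -- the largest eigenvalue and every other index sits at position 1 or later.
  let s := (Fintype.equivOfCardEq (Fintype.card_fin (Fintype.card n)) : Fin (Fintype.card n) ≃ n)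
  let i₀ : n := s ⟨0, by omega⟩
  have small : ∀ i, i ≠ i₀ → hA.eigenvalues i ≤ hA.eigenvalues₀ ⟨1, h⟩ := by
    intro i hi
    refine hA.eigenvalues₀_antitone ?_
    rw [Fin.le_def]
    by_contra hlt
    apply hi
    rw [← s.symm_apply_eq]
    apply Fin.ext
    change (s.symm i).val = 0
    have : ¬ 1 ≤ (s.symm i).val := hlt
    omega
  have hb : ∀ i, i ≠ i₀ → e i ⬝ᵥ u = 0 := by
    intro i hi
    have h1 := coeff i u
    rw [hu, dotProduct_smul, smul_eq_mul] at h1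
    have h2 := small i hi
    have : (μ - hA.eigenvalues i) * (e i ⬝ᵥ u) = 0 := by linarith
    rcases mul_eq_zero.1 this with h3 | h3
    · linarith
    · exact h3
  have hb0 : e i₀ ⬝ᵥ u ≠ 0 := by
    intro h0
    apply hu0
    rw [← dotProduct_self_eq_zero, parseval]
    refine Finset.sum_eq_zero fun i _ => ?_
    by_cases hi : i = i₀
    · rw [hi, h0, zero_mul]
    · rw [hb i hi, zero_mul]
  have hc : e i₀ ⬝ᵥ v = 0 := by
    rw [parseval, Finset.sum_eq_single i₀ (fun i _ hi => by rw [hb i hi, zero_mul]) (by simp)] at huv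
    exact (mul_eq_zero.1 huv).resolve_left hb0
  rw [parseval v (A *ᵥ v), parseval v v, Finset.mul_sum]
  refine Finset.sum_le_sum fun i _ => ?_
  rw [coeff]
  by_cases hi : i = i₀
  · rw [hi, hc]; simp
  · nlinarith [small i hi, mul_self_nonneg (e i ⬝ᵥ v)]

namespace BipGraph

variable {α β : Type} [DecidableEq α] [DecidableEq β]

open Matrix

theorem biadj_mulVec_one {G : BipGraph α β} {DL DR : ℕ} (hG : G.IsBiregular DL DR) :
    G.biadj *ᵥ (fun _ => 1) = fun _ => (DL : ℝ) := by
  funext x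
  rw [← hG.1 x x.2]
  simp only [mulVec, dotProduct, biadj, of_apply, mul_one]
  rw [Finset.card_filter, Nat.cast_sum, ← Finset.sum_coe_sort G.R]
  exact Finset.sum_congr rfl fun y _ => by split_ifs <;> simp

theorem biadj_transpose_mulVec_one {G : BipGraph α β} {DL DR : ℕ} (hG : G.IsBiregular DL DR) :
    G.biadjᵀ *ᵥ (fun _ => 1) = fun _ => (DR : ℝ) := by
  funext y
  rw [← hG.2 y y.2]
  simp only [mulVec, dotProduct, biadj, of_apply, mul_one, transpose_apply]
  rw [Finset.card_filter, Nat.cast_sum, ← Finset.sum_coe_sort G.L]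
  exact Finset.sum_congr rfl fun y _ => by split_ifs <;> simp

/-- The bilinear form of the biadjacency matrix on functions with zero sums. -/
theorem two_mul_dotProduct_biadj_le {G : BipGraph α β} {DL DR : ℕ} {lam : ℝ}
    (hG : G.IsBiregular DL DR) (hDL : 0 < DL) (hcard : 1 < Fintype.card (G.L ⊕ G.R))
    (hlam : G.secondEigenvalue ≤ lam) (hlam' : lam < √DL * √DR)
    (f : G.L → ℝ) (g : G.R → ℝ) (hf : ∑ x, f x = 0) (hg : ∑ y, g y = 0) (hL : G.L.Nonempty) :
    2 * (f ⬝ᵥ G.biadj *ᵥ g) ≤ lam * (f ⬝ᵥ f + g ⬝ᵥ g) := by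
  have h2 : G.adj_isHermitian.eigenvalues₀ ⟨1, hcard⟩ ≤ lam := by
    rwa [secondEigenvalue, dif_pos hcard] at hlam
  have sL : √(DL : ℝ) * √DL = DL := Real.mul_self_sqrt (Nat.cast_nonneg _)
  have sR : √(DR : ℝ) * √DR = DR := Real.mul_self_sqrt (Nat.cast_nonneg _)
  -- The Perron vector of a biregular graph, with eigenvalue `√(DL * DR)`. Any vector with zero sum
  -- on each side is orthogonal to it.
  let u : G.L ⊕ G.R → ℝ := Sum.elim (fun _ => √DL) (fun _ => √DR)
  have hu : G.adj *ᵥ u = (√DL * √DR) • u := by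
    have e1 : (fun _ : G.R => √(DR : ℝ)) = √DR • (fun _ : G.R => (1 : ℝ)) := by
      funext; simp
    have e2 : (fun _ : G.L => √(DL : ℝ)) = √DL • (fun _ : G.L => (1 : ℝ)) := by
      funext; simp
    simp only [adj, u, fromBlocks_mulVec, zero_mulVec, zero_add, add_zero, Sum.elim_comp_inl,
      Sum.elim_comp_inr]
    rw [e1, e2, mulVec_smul, mulVec_smul, biadj_mulVec_one hG, biadj_transpose_mulVec_one hG]
    funext z
    rcases z with x | y
    · simp only [Sum.elim_inl, Pi.smul_apply, smul_eq_mul]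
      linear_combination (-√(DR : ℝ)) * sL
    · simp only [Sum.elim_inr, Pi.smul_apply, smul_eq_mul]
      linear_combination (-√(DL : ℝ)) * sR
  have hu0 : u ≠ 0 := by
    obtain ⟨x, hx⟩ := hL
    intro h0
    have := congrFun h0 (Sum.inl ⟨x, hx⟩)
    simp only [u, Sum.elim_inl, Pi.zero_apply] at this
    rw [Real.sqrt_eq_zero (Nat.cast_nonneg _)] at this
    exact hDL.ne' (by exact_mod_cast this)
  let v : G.L ⊕ G.R → ℝ := Sum.elim f g
  have huv : u ⬝ᵥ v = 0 := by
    simp only [u, v, sumElim_dotProduct_sumElim]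
    simp only [dotProduct, ← Finset.mul_sum, hf, hg, mul_zero, add_zero]
  have key := G.adj_isHermitian.dotProduct_mulVec_le_of_dotProduct_eq_zero hcard hu hu0
    (h2.trans_lt hlam') huv
  have hvv : v ⬝ᵥ v = f ⬝ᵥ f + g ⬝ᵥ g := sumElim_dotProduct_sumElim ..
  have hvAv : v ⬝ᵥ G.adj *ᵥ v = 2 * (f ⬝ᵥ G.biadj *ᵥ g) := by
    simp only [adj, v, fromBlocks_mulVec, zero_mulVec, zero_add, add_zero, Sum.elim_comp_inl,
      Sum.elim_comp_inr, sumElim_dotProduct_sumElim]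
    rw [mulVec_transpose, dotProduct_comm g, ← dotProduct_mulVec]
    ring
  rw [hvAv, hvv] at key
  refine key.trans (mul_le_mul_of_nonneg_right h2 ?_)
  have h3 := dotProduct_star_self_nonneg f
  have h4 := dotProduct_star_self_nonneg g
  simp only [star_trivial] at h3 h4
  linarith

/-- The expander mixing lemma for functions with zero sums. -/
theorem dotProduct_biadj_le {G : BipGraph α β} {DL DR : ℕ} {lam : ℝ}
    (hG : G.IsBiregular DL DR) (hDL : 0 < DL) (hcard : 1 < Fintype.card (G.L ⊕ G.R))
    (hlam : G.secondEigenvalue ≤ lam) (hlam' : lam < √DL * √DR)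
    (f : G.L → ℝ) (g : G.R → ℝ) (hf : ∑ x, f x = 0) (hg : ∑ y, g y = 0) (hL : G.L.Nonempty) :
    f ⬝ᵥ G.biadj *ᵥ g ≤ lam * (√(f ⬝ᵥ f) * √(g ⬝ᵥ g)) := by
  have h3 := dotProduct_star_self_nonneg f
  have h4 := dotProduct_star_self_nonneg g
  simp only [star_trivial] at h3 h4
  by_cases hf0 : f = 0
  · simp [hf0]
  by_cases hg0 : g = 0
  · simp [hg0]
  have ha : 0 < √(f ⬝ᵥ f) :=
    Real.sqrt_pos.2 (h3.lt_of_ne fun h => hf0 (dotProduct_self_eq_zero.1 h.symm))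
  have hb : 0 < √(g ⬝ᵥ g) :=
    Real.sqrt_pos.2 (h4.lt_of_ne fun h => hg0 (dotProduct_self_eq_zero.1 h.symm))
  have qa := Real.mul_self_sqrt h3
  have qb := Real.mul_self_sqrt h4
  set a := √(f ⬝ᵥ f)
  set b := √(g ⬝ᵥ g)
  -- Rescaling gives both functions the same norm `a * b`, so that the arithmetic mean in the
  -- quadratic bound becomes the product of the norms.
  have key := two_mul_dotProduct_biadj_le hG hDL hcard hlam hlam' (b • f) (a • g)
    (by simp only [Pi.smul_apply, smul_eq_mul, ← Finset.mul_sum, hf, mul_zero])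
    (by simp only [Pi.smul_apply, smul_eq_mul, ← Finset.mul_sum, hg, mul_zero]) hL
  simp only [mulVec_smul, dotProduct_smul, smul_dotProduct, smul_eq_mul] at key
  rw [← qa, ← qb] at key
  have hab : 0 < a * b := mul_pos ha hb
  refine le_of_mul_le_mul_left ?_ hab
  nlinarith

/-- The expander mixing lemma, in a form with weights on the vertices. -/
theorem sum_edges_le {G : BipGraph α β} {DL DR : ℕ} {lam : ℝ}
    (hG : G.IsBiregular DL DR) (hDL : 0 < DL) (hcard : 1 < Fintype.card (G.L ⊕ G.R))
    (hlam : G.secondEigenvalue ≤ lam) (hlam0 : 0 ≤ lam) (hlam' : lam < √DL * √DR)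
    (hL : 0 < G.L.card) (hR : 0 < G.R.card) (f : α → ℝ) (g : β → ℝ) :
    ∑ e ∈ G.E, f e.1 * g e.2 ≤ (∑ x ∈ G.L, f x) * (∑ y ∈ G.R, g y) * (DL / G.R.card) +
      lam * (√(∑ x ∈ G.L, f x ^ 2) * √(∑ y ∈ G.R, g y ^ 2)) := by
  have hL' : (G.L.card : ℝ) ≠ 0 := by exact_mod_cast hL.ne'
  have hR' : (G.R.card : ℝ) ≠ 0 := by exact_mod_cast hR.ne'
  set F := ∑ x ∈ G.L, f x with hF
  set Γ := ∑ y ∈ G.R, g y with hΓ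
  let f₁ : G.L → ℝ := fun x => f x
  let g₁ : G.R → ℝ := fun y => g y
  have sF : ∑ x, f₁ x = F := Finset.sum_coe_sort G.L f
  have sG : ∑ y, g₁ y = Γ := Finset.sum_coe_sort G.R g
  -- Subtracting the means leaves the zero-sum parts. The constant parts contribute the main term.
  let f₀ : G.L → ℝ := f₁ - (F / G.L.card) • (fun _ => 1)
  let g₀ : G.R → ℝ := g₁ - (Γ / G.R.card) • (fun _ => 1)
  have hf₀ : ∑ x, f₀ x = 0 := by
    simp only [f₀, Pi.sub_apply, Pi.smul_apply, smul_eq_mul, mul_one, Finset.sum_sub_distrib, sF,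
      Finset.sum_const, Finset.card_univ, Fintype.card_coe, nsmul_eq_mul]
    field_simp; ring
  have hg₀ : ∑ x, g₀ x = 0 := by
    simp only [g₀, Pi.sub_apply, Pi.smul_apply, smul_eq_mul, mul_one, Finset.sum_sub_distrib, sG,
      Finset.sum_const, Finset.card_univ, Fintype.card_coe, nsmul_eq_mul]
    field_simp; ring
  have key := dotProduct_biadj_le hG hDL hcard hlam hlam' f₀ g₀ hf₀ hg₀ (Finset.card_pos.1 hL)
  have one_dot : ∀ h : G.L → ℝ, h ⬝ᵥ (fun _ => 1) = ∑ x, h x := by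
    intro h; simp [dotProduct]
  have one_dot' : ∀ h : G.R → ℝ, h ⬝ᵥ (fun _ => 1) = ∑ x, h x := by
    intro h; simp [dotProduct]
  have hE : f₁ ⬝ᵥ G.biadj *ᵥ g₁ = ∑ e ∈ G.E, f e.1 * g e.2 := by
    have : ∑ e ∈ G.E, f e.1 * g e.2
        = ∑ e ∈ G.L ×ˢ G.R, if e ∈ G.E then f e.1 * g e.2 else 0 := by
      rw [← Finset.sum_filter, Finset.filter_mem_eq_inter,
        Finset.inter_eq_right.2 G.E_subset]
    rw [this, Finset.sum_product, ← Finset.sum_coe_sort G.L]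
    refine Finset.sum_congr rfl fun x _ => ?_
    rw [← Finset.sum_coe_sort G.R, mulVec, dotProduct, Finset.mul_sum]
    refine Finset.sum_congr rfl fun y _ => ?_
    simp only [biadj, of_apply, f₁, g₁]
    split_ifs <;> simp
  -- Biregularity sends constants to constants, so the cross terms vanish. The two ways of counting
  -- edges, `DR * |R| = DL * |L|`, make the main term symmetric.
  have hE₀ : f₀ ⬝ᵥ G.biadj *ᵥ g₀ = f₁ ⬝ᵥ G.biadj *ᵥ g₁ - F * Γ * (DL / G.R.card) := by
    have e1 : f₀ ⬝ᵥ G.biadj *ᵥ (fun _ => 1) = 0 := by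
      rw [biadj_mulVec_one hG]
      simp only [dotProduct, ← Finset.sum_mul, hf₀, zero_mul]
    have e2 : (fun _ => (1 : ℝ)) ⬝ᵥ G.biadj *ᵥ g₁ = DR * Γ := by
      rw [dotProduct_mulVec, ← mulVec_transpose, biadj_transpose_mulVec_one hG]
      simp only [dotProduct, ← Finset.mul_sum, sG]
    have e4 : f₁ ⬝ᵥ G.biadj *ᵥ (fun _ => 1) = DL * F := by
      rw [biadj_mulVec_one hG]
      simp only [dotProduct, ← Finset.sum_mul, sF]; ring
    have e3 : (DR : ℝ) * G.R.card = DL * G.L.card := by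
      have t1 : (fun _ => (1 : ℝ)) ⬝ᵥ G.biadj *ᵥ (fun _ => (1 : ℝ)) = DL * G.L.card := by
        rw [biadj_mulVec_one hG]; simp [dotProduct, mul_comm]
      have t2 : (fun _ => (1 : ℝ)) ⬝ᵥ G.biadj *ᵥ (fun _ => (1 : ℝ)) = DR * G.R.card := by
        rw [dotProduct_mulVec, ← mulVec_transpose, biadj_transpose_mulVec_one hG]
        simp [dotProduct, mul_comm]
      rw [← t1, ← t2]
    have : f₀ ⬝ᵥ G.biadj *ᵥ g₀ = f₀ ⬝ᵥ G.biadj *ᵥ g₁ := by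
      simp only [g₀]
      rw [mulVec_sub, mulVec_smul, dotProduct_sub, dotProduct_smul, e1, smul_zero, sub_zero]
    rw [this]
    simp only [f₀]
    rw [sub_dotProduct, smul_dotProduct, e2, smul_eq_mul]
    congr 1
    field_simp
    linear_combination (F * Γ) * e3
  -- Removing the mean is an orthogonal projection, so the norm does not grow.
  have hff : f₀ ⬝ᵥ f₀ ≤ ∑ x ∈ G.L, f x ^ 2 := by
    have : f₀ ⬝ᵥ f₀ = f₀ ⬝ᵥ f₁ := by
      conv_lhs => rw [show f₀ ⬝ᵥ f₀ = f₀ ⬝ᵥ (f₁ - (F / G.L.card) • (fun _ => 1)) from rfl]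
      rw [dotProduct_sub, dotProduct_smul, one_dot, hf₀, smul_zero, sub_zero]
    rw [this]
    simp only [f₀]
    rw [sub_dotProduct, smul_dotProduct, dotProduct_comm (fun _ => (1 : ℝ)) f₁, one_dot, sF,
      smul_eq_mul]
    have e : f₁ ⬝ᵥ f₁ = ∑ x ∈ G.L, f x ^ 2 := by
      rw [← Finset.sum_coe_sort G.L]
      exact Finset.sum_congr rfl fun x _ => by simp only [f₁]; ring
    rw [e]
    have : 0 ≤ F / G.L.card * F := by
      rw [div_mul_eq_mul_div]; exact div_nonneg (mul_self_nonneg _) (Nat.cast_nonneg _)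
    linarith
  have hgg : g₀ ⬝ᵥ g₀ ≤ ∑ x ∈ G.R, g x ^ 2 := by
    have : g₀ ⬝ᵥ g₀ = g₀ ⬝ᵥ g₁ := by
      conv_lhs => rw [show g₀ ⬝ᵥ g₀ = g₀ ⬝ᵥ (g₁ - (Γ / G.R.card) • (fun _ => 1)) from rfl]
      rw [dotProduct_sub, dotProduct_smul, one_dot', hg₀, smul_zero, sub_zero]
    rw [this]
    simp only [g₀]
    rw [sub_dotProduct, smul_dotProduct, dotProduct_comm (fun _ => (1 : ℝ)) g₁, one_dot', sG,
      smul_eq_mul]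
    have e : g₁ ⬝ᵥ g₁ = ∑ x ∈ G.R, g x ^ 2 := by
      rw [← Finset.sum_coe_sort G.R]
      exact Finset.sum_congr rfl fun x _ => by simp only [g₁]; ring
    rw [e]
    have : 0 ≤ Γ / G.R.card * Γ := by
      rw [div_mul_eq_mul_div]; exact div_nonneg (mul_self_nonneg _) (Nat.cast_nonneg _)
    linarith
  rw [hE₀, hE] at key
  have := mul_le_mul_of_nonneg_left (mul_le_mul (Real.sqrt_le_sqrt hff) (Real.sqrt_le_sqrt hgg)
    (Real.sqrt_nonneg _) (Real.sqrt_nonneg _)) hlam0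
  linarith

/-! ### Counting edges in the amplified graph -/

theorem card_bitStrings (m : ℕ) : (bitStrings m).card = 2 ^ m := by
  rw [bitStrings, Finset.card_image_of_injective _ List.ofFn_injective]
  simp

theorem mem_bitStrings {m : ℕ} {s : List Bool} : s ∈ bitStrings m ↔ s.length = m := by
  simp only [bitStrings, Finset.mem_image, Finset.mem_univ, true_and]
  constructor
  · rintro ⟨f, rfl⟩; simp
  · rintro rfl; exact ⟨s.get, List.ofFn_get s⟩

/-- The number of edges between two sets of vertices of the amplification of a good expander. -/
theorem card_amplify_edges_le {G : BipGraph α β} {q d m : ℕ} (hq : 2 ≤ q) (hd : 1 ≤ d)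
    (hG : G.HasStandardParameters q d) (hexp : G.IsGoodSpectralExpander (q ^ d) q)
    (S : Finset (α × List Bool)) (T : Finset (β × List Bool)) :
    (((G.amplify m).E.filter fun e => e.1 ∈ S ∧ e.2 ∈ T).card : ℝ) ≤
      (S.card : ℝ) * T.card / q + √((q : ℝ) ^ d) * 2 ^ m * √((S.card : ℝ) * T.card) := by
  classical
  have hq0 : 0 < q := by omega
  -- Weighting each vertex of `G` by the size of its fiber in `S` or `T` reduces the count to `G`
  -- itself; the spectrum of the amplification is not needed.
  let f : α → ℝ := fun x => ((bitStrings m).filter fun r => (x, r) ∈ S).card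
  let g : β → ℝ := fun y => ((bitStrings m).filter fun r => (y, r) ∈ T).card
  have hf0 : ∀ x, 0 ≤ f x := fun x => Nat.cast_nonneg _
  have hg0 : ∀ x, 0 ≤ g x := fun x => Nat.cast_nonneg _
  have hfm : ∀ x, f x ≤ 2 ^ m := fun x => by
    have := Finset.card_filter_le (bitStrings m) fun r => (x, r) ∈ S
    rw [card_bitStrings] at this
    simp only [f]
    exact_mod_cast this
  have hgm : ∀ x, g x ≤ 2 ^ m := fun x => by
    have := Finset.card_filter_le (bitStrings m) fun r => (x, r) ∈ T
    rw [card_bitStrings] at this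
    simp only [g]
    exact_mod_cast this
  have hfS : ∑ x ∈ G.L, f x ≤ S.card := by
    have : ∑ x ∈ G.L, ((bitStrings m).filter fun r => (x, r) ∈ S).card ≤ S.card := by
      rw [← Finset.card_sigma]
      refine Finset.card_le_card_of_injOn (fun p => (p.1, p.2)) ?_ ?_
      · rintro ⟨x, r⟩ h
        simp at h ⊢; exact h.2.2
      · rintro ⟨x, r⟩ _ ⟨x', r'⟩ _ h
        simp at h ⊢; exact h
    simp only [f]
    exact_mod_cast this
  have hgT : ∑ x ∈ G.R, g x ≤ T.card := by
    have : ∑ x ∈ G.R, ((bitStrings m).filter fun r => (x, r) ∈ T).card ≤ T.card := by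
      rw [← Finset.card_sigma]
      refine Finset.card_le_card_of_injOn (fun p => (p.1, p.2)) ?_ ?_
      · rintro ⟨x, r⟩ h
        simp at h ⊢; exact h.2.2
      · rintro ⟨x, r⟩ _ ⟨x', r'⟩ _ h
        simp at h ⊢; exact h
    simp only [g]
    exact_mod_cast this
  have hE : (((G.amplify m).E.filter fun e => e.1 ∈ S ∧ e.2 ∈ T).card : ℝ)
      ≤ ∑ e ∈ G.E, f e.1 * g e.2 := by
    have : ((G.amplify m).E.filter fun e => e.1 ∈ S ∧ e.2 ∈ T).card ≤
        ∑ e ∈ G.E, ((bitStrings m).filter fun r => (e.1, r) ∈ S).card *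
          ((bitStrings m).filter fun r => (e.2, r) ∈ T).card := by
      simp_rw [← Finset.card_product]
      rw [← Finset.card_sigma]
      refine Finset.card_le_card_of_injOn
        (fun e => ⟨(e.1.1, e.2.1), (e.1.2, e.2.2)⟩) ?_ ?_
      · rintro ⟨⟨x, r⟩, ⟨y, r'⟩⟩ h
        simp [amplify] at h ⊢
        tauto
      · rintro ⟨⟨x, r⟩, ⟨y, r'⟩⟩ _ ⟨⟨x₂, r₂⟩, ⟨y₂, r₂'⟩⟩ _ h
        simp at h ⊢; tauto
    simp only [f, g]
    exact_mod_cast this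
  obtain ⟨hLc, hRc, hreg⟩ := hG
  have hcard : 1 < Fintype.card (G.L ⊕ G.R) := by
    rw [Fintype.card_sum, Fintype.card_coe, Fintype.card_coe, hLc, hRc]
    have : 2 ^ 2 ≤ q ^ 2 := Nat.pow_le_pow_left hq 2
    omega
  have hq1 : (1 : ℝ) < q := by exact_mod_cast hq
  have hqd : (q : ℝ) ≤ (q : ℝ) ^ d := le_self_pow₀ hq1.le (by omega)
  have hlam : G.secondEigenvalue ≤ √((q : ℝ) ^ d) := by
    have := hexp.2
    rwa [Nat.cast_pow, max_eq_left hqd] at this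
  have hspos : 0 < √((q : ℝ) ^ d) := Real.sqrt_pos.2 (by positivity)
  -- The spectral gap is strict precisely because `q > 1`.
  have hlam' : √((q : ℝ) ^ d) < √((q ^ d : ℕ) : ℝ) * √(q : ℝ) := by
    rw [Nat.cast_pow]
    have : 1 < √(q : ℝ) := Real.lt_sqrt_of_sq_lt (by rw [one_pow]; exact hq1)
    nlinarith
  have key := sum_edges_le hreg (by positivity) hcard hlam hspos.le hlam'
    (by rw [hLc]; positivity) (by rw [hRc]; positivity) f g
  have hratio : ((q ^ d : ℕ) : ℝ) / G.R.card = 1 / q := by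
    rw [hRc, pow_succ, Nat.cast_mul, div_mul_cancel_left₀ (by positivity), one_div]
  rw [hratio] at key
  -- A fiber has at most `2^m` elements. One factor of the square is bounded by this and the other
  -- is summed, which is the source of `2^m` in the error term.
  have hfsq : ∑ x ∈ G.L, f x ^ 2 ≤ 2 ^ m * S.card := by
    refine le_trans ?_ (mul_le_mul_of_nonneg_left hfS (by positivity))
    rw [Finset.mul_sum]
    exact Finset.sum_le_sum fun x _ => by
      rw [pow_two]; exact mul_le_mul_of_nonneg_right (hfm x) (hf0 x)
  have hgsq : ∑ x ∈ G.R, g x ^ 2 ≤ 2 ^ m * T.card := by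
    refine le_trans ?_ (mul_le_mul_of_nonneg_left hgT (by positivity))
    rw [Finset.mul_sum]
    exact Finset.sum_le_sum fun x _ => by
      rw [pow_two]; exact mul_le_mul_of_nonneg_right (hgm x) (hg0 x)
  have hprod : √(∑ x ∈ G.L, f x ^ 2) * √(∑ y ∈ G.R, g y ^ 2)
      ≤ 2 ^ m * √((S.card : ℝ) * T.card) := by
    rw [← Real.sqrt_mul (Finset.sum_nonneg fun x _ => sq_nonneg _)]
    have h2m : (2 : ℝ) ^ m = √(2 ^ m * 2 ^ m) := by rw [Real.sqrt_mul_self (by positivity)]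
    rw [h2m, ← Real.sqrt_mul (by positivity)]
    clear h2m
    refine Real.sqrt_le_sqrt ?_
    calc _ ≤ (2 ^ m * (S.card : ℝ)) * (2 ^ m * T.card) :=
          mul_le_mul hfsq hgsq (Finset.sum_nonneg fun x _ => sq_nonneg _) (by positivity)
      _ = _ := by ring
  have h1 : (∑ x ∈ G.L, f x) * (∑ y ∈ G.R, g y) ≤ (S.card : ℝ) * T.card :=
    mul_le_mul hfS hgT (Finset.sum_nonneg fun x _ => hg0 x) (Nat.cast_nonneg _)
  calc _ ≤ _ := hE
    _ ≤ _ := key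
    _ ≤ (S.card : ℝ) * T.card * (1 / q) + √((q : ℝ) ^ d) * (2 ^ m * √((S.card : ℝ) * T.card)) :=
        add_le_add (mul_le_mul_of_nonneg_right h1 (by positivity))
          (mul_le_mul_of_nonneg_left hprod hspos.le)
    _ = _ := by ring

end BipGraph

/-! ### Stages of partial computable functions -/

/-- Evaluation of a code with bounded fuel is primitive recursive and monotone in the fuel.
Unbounded computations can thus be searched stage by stage. -/
theorem Partrec.exists_stages {α σ : Type} [Primcodable α] [Primcodable σ] {f : α →. σ}
    (hf : Partrec f) : ∃ g : ℕ → α → Option σ, Primrec₂ g ∧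
      (∀ a x, x ∈ f a ↔ ∃ k, g k a = some x) ∧
      ∀ k k' a x, k ≤ k' → g k a = some x → g k' a = some x := by
  obtain ⟨c, hc⟩ := Nat.Partrec.Code.exists_code.1 hf
  have hce : ∀ a, Nat.Partrec.Code.eval c (Encodable.encode a) = (f a).map Encodable.encode := by
    intro a; rw [hc]; simp
  refine ⟨fun k a => (Nat.Partrec.Code.evaln k c (Encodable.encode a)).bind Encodable.decode,
    ?_, ?_, ?_⟩
  · exact Primrec.option_bind (Nat.Partrec.Code.primrec_evaln.comp
      ((Primrec.fst.pair (Primrec.const c)).pair (Primrec.encode.comp Primrec.snd)))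
      (Primrec.decode.comp Primrec.snd)
  · intro a x
    constructor
    · intro hx
      have : Encodable.encode x ∈ Nat.Partrec.Code.eval c (Encodable.encode a) := by
        rw [hce]; exact Part.mem_map _ hx
      obtain ⟨k, hk⟩ := Nat.Partrec.Code.evaln_complete.1 this
      exact ⟨k, by simp only [Option.mem_def.1 hk, Option.bind_some, Encodable.encodek]⟩
    · rintro ⟨k, hk⟩
      obtain ⟨n, hn, hnx⟩ := Option.bind_eq_some_iff.1 hk
      have := Nat.Partrec.Code.evaln_sound (Option.mem_def.2 hn)
      rw [hce] at this
      obtain ⟨x', hx', rfl⟩ := (Part.mem_map_iff _).1 this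
      rw [Encodable.encodek] at hnx
      cases hnx
      exact hx'
  · intro k k' a x hkk hk
    obtain ⟨n, hn, hnx⟩ := Option.bind_eq_some_iff.1 hk
    have := Nat.Partrec.Code.evaln_mono hkk (Option.mem_def.2 hn)
    simp only [Option.mem_def.1 this, Option.bind_some, hnx]

/-! ### Bit strings as programs -/

/-- The number with the given binary digits, the least significant digit first. -/
def bitsValue (p : List Bool) : ℕ := p.foldr Nat.bit 0

theorem primrec_bitsValue : Primrec bitsValue := by
  have h : Primrec₂ fun (_ : List Bool) (t : Bool × ℕ) => Nat.bit t.1 t.2 :=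
    (Primrec.cond (Primrec.fst.comp Primrec.snd)
      (Primrec.nat_double_succ.comp (Primrec.snd.comp Primrec.snd))
      (Primrec.nat_double.comp (Primrec.snd.comp Primrec.snd))).of_eq fun t => by
        cases h : t.2.1 <;> simp [Nat.bit, h]
  exact Primrec.list_foldr Primrec.id (Primrec.const 0) h

theorem exists_bitsValue_eq : ∀ {s i : ℕ}, i < 2 ^ s → ∃ p : List Bool,
    p.length = s ∧ bitsValue p = i
  | 0, i, h => ⟨[], rfl, by simp at h; simp [h, bitsValue]⟩
  | s + 1, i, h => by
    obtain ⟨p, hp, hpi⟩ := exists_bitsValue_eq (s := s) (i := i.div2) (by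
      rw [Nat.div2_val]; rw [pow_succ] at h; omega)
    exact ⟨i.bodd :: p, by simp [hp], by
      rw [bitsValue, List.foldr_cons, ← bitsValue, hpi, Nat.bit_bodd_div2]⟩

/-- The length of the first block of a program that consists of two blocks. -/
def headerLength (p : List Bool) : ℕ := (p.takeWhile id).length

/-- Splits a program into two parts; the length of the first part is given in a self-delimiting
header. -/
def splitProgram (p : List Bool) : List Bool × List Bool :=
  let t := headerLength p
  let r := p.drop (t + 1)
  let l := bitsValue (r.take t)
  ((r.drop t).take l, (r.drop t).drop l)

theorem primrec_splitProgram : Primrec splitProgram := by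
  have ht : Primrec headerLength :=
    Primrec.list_length.comp (Primrec.list_takeWhile Primrec.id)
  have hr : Primrec fun p => List.drop (headerLength p + 1) p :=
    Primrec.list_drop.comp (Primrec.succ.comp ht) Primrec.id
  have hl : Primrec fun p => bitsValue ((List.drop (headerLength p + 1) p).take (headerLength p)) :=
    primrec_bitsValue.comp (Primrec.list_take.comp ht hr)
  have hd := Primrec.list_drop.comp ht hr
  exact (Primrec.list_take.comp hl hd).pair (Primrec.list_drop.comp hl hd)

/-- The layout is: the bit length of `|u|` in unary, a stop bit, `|u|` in binary, then `u` and `v`.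
Concatenating two programs therefore costs only a logarithmic overhead. -/
theorem exists_splitProgram_eq (u v : List Bool) : ∃ p, splitProgram p = (u, v) ∧
    p.length = u.length + v.length + 2 * Nat.size u.length + 1 := by
  obtain ⟨h, hh, hv⟩ := exists_bitsValue_eq (Nat.lt_size_self u.length)
  refine ⟨List.replicate (Nat.size u.length) true ++ false :: (h ++ (u ++ v)), ?_, ?_⟩
  · have ht : headerLength (List.replicate (Nat.size u.length) true ++ false :: (h ++ (u ++ v)))
        = Nat.size u.length := by
      rw [headerLength, List.takeWhile_append_of_pos (by simp)]
      simp
    have hr : List.drop (Nat.size u.length + 1)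
        (List.replicate (Nat.size u.length) true ++ false :: (h ++ (u ++ v))) = h ++ (u ++ v) := by
      rw [List.drop_append]; simp
    simp only [splitProgram, ht, hr]
    rw [← hh, List.take_left, List.drop_left, hv, List.take_left, List.drop_left]
  · simp [hh]; ring

/-! ### Basic properties of conditional complexity -/

theorem condC_encode (U : List Bool × ℕ →. ℕ) {α β : Type} [Primcodable α] [Primcodable β]
    (a : α) (b : β) : condC U (Encodable.encode a) (Encodable.encode b) = condC U a b := rfl

namespace IsOptimal

variable {U : List Bool × ℕ →. ℕ} {α β γ : Type} [Primcodable α] [Primcodable β] [Primcodable γ]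

theorem condC_le_length {p : List Bool} {a : α} {b : β}
    (h : Encodable.encode a ∈ U (p, Encodable.encode b)) : condC U a b ≤ p.length :=
  Nat.sInf_le ⟨p, rfl, h⟩

theorem exists_condC_le_of_mem (hU : IsOptimal U) {V : List Bool × β →. α} (hV : Partrec V) :
    ∃ c : ℕ, ∀ p b a, a ∈ V (p, b) → condC U a b ≤ p.length + c := by
  let V' : List Bool × ℕ →. ℕ := fun t =>
    ((Encodable.decode t.2 : Option β) : Part β).bind fun b => (V (t.1, b)).map Encodable.encode
  have hV' : Partrec V' := by
    refine Partrec.bind (Computable.ofOption (Computable.decode.comp Computable.snd)) ?_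
    exact Partrec.map (hV.comp ((Computable.fst.comp Computable.fst).pair Computable.snd))
      (Computable.encode.comp Computable.snd)
  obtain ⟨c, hc⟩ := hU.2 V' hV'
  refine ⟨c, fun p b a ha => ?_⟩
  obtain ⟨p', hp', hmem⟩ := hc p (Encodable.encode a) (Encodable.encode b) (by
    simp only [V', Encodable.encodek, Part.coe_some, Part.bind_some]
    exact Part.mem_map _ ha)
  exact (condC_le_length hmem).trans hp'

theorem exists_program (hU : IsOptimal U) (a : α) (b : β) :
    ∃ p : List Bool, p.length = condC U a b ∧ Encodable.encode a ∈ U (p, Encodable.encode b) := by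
  -- Since `sInf ∅ = 0`, nonemptiness is what makes the infimum attained. A constant method supplies
  -- a program.
  have hne : {l : ℕ | ∃ p : List Bool, p.length = l ∧
      Encodable.encode a ∈ U (p, Encodable.encode b)}.Nonempty := by
    obtain ⟨c, hc⟩ := hU.2 (fun _ => Part.some (Encodable.encode a))
      (Computable.const (Encodable.encode a))
    obtain ⟨p, -, hp⟩ := hc [] (Encodable.encode a) (Encodable.encode b) (Part.mem_some _)
    exact ⟨_, p, rfl, hp⟩
  exact Nat.sInf_mem hne

theorem exists_condC_comp_le (hU : IsOptimal U) {f : α → β → γ} (hf : Computable₂ f) :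
    ∃ c : ℕ, ∀ a b, condC U (f a b) b ≤ condC U a b + c := by
  have hV : Partrec fun t : List Bool × β => (U (t.1, Encodable.encode t.2)).bind fun n =>
      (((Encodable.decode n : Option α).map fun a => f a t.2 : Option γ) : Part γ) := by
    refine Partrec.bind (hU.1.comp (Computable.fst.pair (Computable.encode.comp Computable.snd))) ?_
    refine Computable.ofOption ?_
    refine Computable.option_map (Computable.decode.comp Computable.snd) ?_
    exact hf.comp Computable.snd (Computable.snd.comp (Computable.fst.comp Computable.fst))
  obtain ⟨c, hc⟩ := hU.exists_condC_le_of_mem hV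
  refine ⟨c, fun a b => ?_⟩
  obtain ⟨p, hp, hmem⟩ := hU.exists_program a b
  rw [← hp]
  refine hc p b _ (Part.mem_bind hmem ?_)
  simp

theorem exists_condC_le_condC_comp (hU : IsOptimal U) {g : β → γ} (hg : Computable g) :
    ∃ c : ℕ, ∀ (a : α) (b : β), condC U a b ≤ condC U a (g b) + c := by
  have hV : Partrec fun t : List Bool × β => (U (t.1, Encodable.encode (g t.2))).bind fun n =>
      ((Encodable.decode n : Option α) : Part α) :=
    Partrec.bind (hU.1.comp (Computable.fst.pair
      (Computable.encode.comp (hg.comp Computable.snd))))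
      (Computable.ofOption (Computable.decode.comp Computable.snd))
  obtain ⟨c, hc⟩ := hU.exists_condC_le_of_mem hV
  refine ⟨c, fun a b => ?_⟩
  obtain ⟨p, hp, hmem⟩ := hU.exists_program a (g b)
  rw [← hp]
  refine hc p b _ (Part.mem_bind hmem ?_)
  simp

theorem exists_condC_nat_le (hU : IsOptimal U) :
    ∃ c : ℕ, ∀ (e : ℕ) (b : β), condC U e b ≤ Nat.size e + c := by
  have hV : Partrec fun t : List Bool × β => Part.some (bitsValue t.1) :=
    primrec_bitsValue.to_comp.comp Computable.fst
  obtain ⟨c, hc⟩ := hU.exists_condC_le_of_mem hV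
  refine ⟨c, fun e b => ?_⟩
  obtain ⟨p, hp, rfl⟩ := exists_bitsValue_eq (Nat.lt_size_self e)
  rw [← hp]
  exact hc p b _ (Part.mem_some _)

theorem _root_.Nat.size_le_self (n : ℕ) : Nat.size n ≤ n :=
  Nat.size_le.2 n.lt_two_pow_self

theorem exists_condC_vertex_le (hU : IsOptimal U) :
    ∃ c : ℕ, ∀ (x : List Bool × List Bool) (b : β), condC U x b ≤ 3 * vertexLength x + c := by
  have hV : Partrec fun t : List Bool × β => Part.some (splitProgram t.1) :=
    primrec_splitProgram.to_comp.comp Computable.fst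
  obtain ⟨c, hc⟩ := hU.exists_condC_le_of_mem hV
  refine ⟨c + 1, fun x b => ?_⟩
  obtain ⟨p, hp, hl⟩ := exists_splitProgram_eq x.1 x.2
  have := hc p b x (by rw [hp]; exact Part.mem_some _)
  have := Nat.size_le_self x.1.length
  rw [vertexLength]
  omega

/-- The easy half of the chain rule. -/
theorem exists_condC_le_add (hU : IsOptimal U) : ∃ c : ℕ, ∀ (a : α) (b : β) (z : γ),
    condC U a b ≤ condC U z b + condC U a (b, z) + 2 * Nat.size (condC U z b) + c := by
  have hs := primrec_splitProgram.to_comp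
  have hV : Partrec fun t : List Bool × ℕ => (U ((splitProgram t.1).1, t.2)).bind fun z =>
      U ((splitProgram t.1).2, Nat.pair t.2 z) := by
    refine Partrec.bind (hU.1.comp ((Computable.fst.comp (hs.comp Computable.fst)).pair
      Computable.snd)) ?_
    refine hU.1.comp (Computable.pair ?_ ?_)
    · exact Computable.snd.comp (hs.comp (Computable.fst.comp Computable.fst))
    · exact Primrec₂.natPair.to_comp.comp (Computable.snd.comp Computable.fst) Computable.snd
  obtain ⟨c, hc⟩ := hU.exists_condC_le_of_mem hV
  refine ⟨c + 1, fun a b z => ?_⟩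
  obtain ⟨p, hp, hpm⟩ := hU.exists_program z b
  obtain ⟨p', hp', hpm'⟩ := hU.exists_program a (b, z)
  obtain ⟨r, hr, hl⟩ := exists_splitProgram_eq p p'
  have := hc r (Encodable.encode b) (Encodable.encode a) (by
    simp only [hr]
    exact Part.mem_bind hpm hpm')
  rw [condC_encode] at this
  rw [hl, hp, hp'] at this
  omega

/-- A numerical parameter can be dropped from the condition by writing it into the program:
`Nat.size e` bits for `e`, and at most twice as many to delimit them. -/
theorem exists_condC_le_condC_param (hU : IsOptimal U) : ∃ c : ℕ, ∀ (a : α) (b : β) (e : ℕ),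
    condC U a b ≤ condC U a (b, e) + 3 * Nat.size e + c := by
  obtain ⟨c₁, h₁⟩ := hU.exists_condC_nat_le (β := β)
  obtain ⟨c₂, h₂⟩ := hU.exists_condC_le_add (α := α) (β := β) (γ := ℕ)
  refine ⟨3 * c₁ + c₂, fun a b e => ?_⟩
  have e₁ := h₁ e b
  have e₂ := h₂ a b e
  have := Nat.size_le_self (condC U e b)
  omega

/-- Objects of small complexity are few. -/
theorem exists_finset_condC_le (hU : IsOptimal U) (b : β) (k : ℕ) :
    ∃ S : Finset α, (∀ a, a ∈ S ↔ condC U a b ≤ k) ∧ S.card ≤ 2 ^ (k + 1) := by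
  classical
  let P : Finset (List Bool) := (Finset.range (k + 1)).biUnion BipGraph.bitStrings
  let S : Finset α := P.biUnion fun p =>
    ((U (p, Encodable.encode b)).toOption.bind (Encodable.decode (α := α))).toFinset
  have hP : P.card ≤ 2 ^ (k + 1) := by
    refine Finset.card_biUnion_le.trans ?_
    simp_rw [BipGraph.card_bitStrings]
    exact (Nat.geomSum_lt (m := 2) (n := k + 1) le_rfl (s := Finset.range (k + 1))
      (by simp)).le
  have hS : S.card ≤ 2 ^ (k + 1) := by
    refine le_trans ?_ hP
    have := Finset.card_biUnion_le_card_mul P (fun p =>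
      ((U (p, Encodable.encode b)).toOption.bind (Encodable.decode (α := α))).toFinset) 1
      fun p _ => by
        cases (U (p, Encodable.encode b)).toOption.bind (Encodable.decode (α := α)) <;> simp
    simpa using this
  have hmem : ∀ a, condC U a b ≤ k → a ∈ S := by
    intro a ha
    obtain ⟨p, hp, hpm⟩ := hU.exists_program a b
    refine Finset.mem_biUnion.2 ⟨p, ?_, ?_⟩
    · exact Finset.mem_biUnion.2 ⟨p.length, by simp; omega, BipGraph.mem_bitStrings.2 rfl⟩
    · have : (U (p, Encodable.encode b)).toOption = some (Encodable.encode a) := by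
        rw [← Option.mem_def, Part.mem_toOption]; exact hpm
      simp [this]
  refine ⟨S.filter fun a => condC U a b ≤ k, fun a => ?_, (Finset.card_filter_le _ _).trans hS⟩
  rw [Finset.mem_filter]
  exact ⟨fun h => h.2, fun h => ⟨hmem a h, h⟩⟩

/-- The relation `C(a | b) ≤ k` is the union of an increasing primitive recursive sequence of
relations. -/
theorem exists_stages_condC_le (hU : IsOptimal U) : ∃ M : ℕ → ℕ → ℕ → ℕ → Prop,
    PrimrecPred (fun t : ((ℕ × ℕ) × ℕ) × ℕ => M t.1.1.1 t.1.1.2 t.1.2 t.2) ∧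
    (∀ K b a k k', k ≤ k' → M K b a k → M K b a k') ∧
    ∀ K b a, condC U a b ≤ K ↔ ∃ k, M K b a k := by
  obtain ⟨g, hg, hgU, hmono⟩ := hU.1.exists_stages
  let progs : ℕ → List (List Bool) := fun k =>
    (List.range k).filterMap (fun n => (Encodable.decode n : Option (List Bool)))
  have hprogs : Primrec progs :=
    Primrec.listFilterMap Primrec.list_range (Primrec.decode.comp Primrec.snd)
  have mem_progs : ∀ k p, p ∈ progs k ↔ ∃ n < k, Encodable.decode n = some p := by
    intro k p; simp [progs]
  refine ⟨fun K b a k => ∃ p ∈ progs k, p.length ≤ K ∧ g k (p, b) = some a, ?_, ?_, ?_⟩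
  · have hR : PrimrecRel fun (p : List Bool) (t : ((ℕ × ℕ) × ℕ) × ℕ) =>
        p.length ≤ t.1.1.1 ∧ g t.2 (p, t.1.1.2) = some t.1.2 := by
      have t11 : Primrec fun s : List Bool × ((ℕ × ℕ) × ℕ) × ℕ => s.2.1.1 :=
        Primrec.fst.comp (Primrec.fst.comp Primrec.snd)
      refine PrimrecPred.and ?_ ?_
      · exact Primrec.nat_le.comp (Primrec.list_length.comp Primrec.fst) (Primrec.fst.comp t11)
      · refine Primrec.eq.comp (hg.comp (Primrec.snd.comp Primrec.snd)
          (Primrec.fst.pair (Primrec.snd.comp t11))) (Primrec.option_some.comp ?_)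
        exact Primrec.snd.comp (Primrec.fst.comp Primrec.snd)
    exact hR.exists_mem_list.comp (hprogs.comp Primrec.snd) Primrec.id
  · rintro K b a k k' hkk ⟨p, hp, hl, hgp⟩
    obtain ⟨n, hn, hd⟩ := (mem_progs k p).1 hp
    exact ⟨p, (mem_progs k' p).2 ⟨n, hn.trans_le hkk, hd⟩, hl, hmono _ _ _ _ hkk hgp⟩
  · intro K b a
    constructor
    · intro h
      obtain ⟨p, hp, hpm⟩ := hU.exists_program a b
      obtain ⟨k, hk⟩ := (hgU _ _).1 hpm
      refine ⟨max k (Encodable.encode p + 1), p, ?_, by omega, hmono _ _ _ _ (le_max_left _ _) hk⟩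
      exact (mem_progs _ p).2 ⟨Encodable.encode p, by
        exact lt_of_lt_of_le (Nat.lt_succ_self _) (le_max_right _ _), Encodable.encodek p⟩
    · rintro ⟨k, p, -, hl, hgp⟩
      exact (condC_le_length ((hgU _ _).2 ⟨k, hgp⟩)).trans hl

end IsOptimal

/-! ### Enumerable sets and symmetry of information -/

namespace IsOptimal

variable {U : List Bool × ℕ →. ℕ} {α β γ : Type} [Primcodable α] [Primcodable β] [Primcodable γ]

/-- An element of an enumerable set with at most `2 ^ s` elements has complexity at most `s`, up to
a constant, if the condition is sufficient for the enumeration. -/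
theorem exists_condC_le_of_enumeration (hU : IsOptimal U) {R : β → α → ℕ → Prop}
    (hR : PrimrecPred fun t : (β × α) × ℕ => R t.1.1 t.1.2 t.2) :
    ∃ c : ℕ, ∀ (b : β) (s : ℕ) (S : Finset α), (∀ a k, R b a k → a ∈ S) → S.card ≤ 2 ^ s →
      ∀ a k, R b a k → condC U a b ≤ s + c := by
  classical
  -- The index `j` codes a candidate together with a stage, so `e b` lists all `a` with `R b a k`
  -- for some `k`, with repetitions.
  let e : β → ℕ → Option α := fun b j => (Encodable.decode j.unpair.1 : Option α).bind fun a =>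
    if R b a j.unpair.2 then some a else none
  have he : Primrec₂ e := by
    refine Primrec.option_bind
      (Primrec.decode.comp (Primrec.fst.comp (Primrec.unpair.comp Primrec.snd))) ?_
    refine Primrec.ite (hR.comp (((Primrec.fst.comp Primrec.fst).pair Primrec.snd).pair
      (Primrec.snd.comp (Primrec.unpair.comp (Primrec.snd.comp Primrec.fst)))))
      (Primrec.option_some.comp Primrec.snd) (Primrec.const none)
  have e_sound : ∀ b j a, e b j = some a → R b a j.unpair.2 := by
    intro b j a h
    obtain ⟨a', -, h'⟩ := Option.bind_eq_some_iff.1 h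
    split_ifs at h' with hr
    cases h'; exact hr
  have e_complete : ∀ b a k, R b a k → ∃ j, e b j = some a := by
    intro b a k h
    refine ⟨Nat.pair (Encodable.encode a) k, ?_⟩
    simp only [e, Nat.unpair_pair, Encodable.encodek, Option.bind_some, if_pos h]
  let new : ℕ → β → Prop := fun j b => (e b j).isSome = true ∧ ∀ i ∈ List.range j, e b i ≠ e b j
  have hnew : PrimrecRel new := by
    have h1 : PrimrecRel fun (i : ℕ) (t : ℕ × β) => e t.2 i ≠ e t.2 t.1 :=
      (Primrec.eq.comp (he.comp (Primrec.snd.comp Primrec.snd) Primrec.fst)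
        (he.comp (Primrec.snd.comp Primrec.snd) (Primrec.fst.comp Primrec.snd))).not
    refine PrimrecPred.and ?_ (h1.forall_mem_list.comp (Primrec.list_range.comp Primrec.fst)
      Primrec.id)
    exact Primrec.eq.comp (Primrec.option_isSome.comp (he.comp Primrec.snd Primrec.fst))
      (Primrec.const true)
  -- The position of an element in the list with repetitions removed. Its binary digits will serve
  -- as the program.
  let rank : β → ℕ → ℕ := fun b j => ((List.range j).filter fun i => new i b).length
  have hrank : Primrec₂ rank :=
    Primrec.list_length.comp (hnew.listFilter.comp (Primrec.list_range.comp Primrec.snd) Primrec.fst)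
  have rank_mono : ∀ b i j, i < j → new i b → rank b i < rank b j := by
    intro b i j hij hi
    have h1 : rank b (i + 1) = rank b i + 1 := by
      simp only [rank, List.range_succ, List.filter_append, List.length_append]
      simp [hi]
    have h2 : rank b (i + 1) ≤ rank b j := by
      refine List.Sublist.length_le (List.Sublist.filter _ ?_)
      exact List.range_sublist.2 hij
    omega
  let f : List Bool × β → ℕ → Option α := fun t j =>
    if new j t.2 ∧ rank t.2 j = bitsValue t.1 then e t.2 j else none
  have hf : Primrec₂ f := by
    refine Primrec.ite (PrimrecPred.and ?_ ?_) ?_ (Primrec.const none)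
    · exact hnew.comp Primrec.snd (Primrec.snd.comp Primrec.fst)
    · exact Primrec.eq.comp (hrank.comp (Primrec.snd.comp Primrec.fst) Primrec.snd)
        (primrec_bitsValue.comp (Primrec.fst.comp Primrec.fst))
    · exact he.comp (Primrec.snd.comp Primrec.fst) Primrec.snd
  obtain ⟨c, hc⟩ := hU.exists_condC_le_of_mem (Partrec.rfindOpt hf.to_comp)
  refine ⟨c, fun b s S hS hcard a k hak => ?_⟩
  have hex := e_complete b a k hak
  let j := Nat.find hex
  have hj : e b j = some a := Nat.find_spec hex
  have hnj : new j b := by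
    refine ⟨by rw [hj]; rfl, fun i hi h => ?_⟩
    rw [hj] at h
    exact Nat.find_min hex (List.mem_range.1 hi) h
  have hlt : rank b j < 2 ^ s := by
    -- The `+ 1` counts `j` itself, which makes the rank strictly smaller than `|S|`.
    have hnodup : (((List.range (j + 1)).filter fun i => new i b).toFinset).card = rank b j + 1 := by
      rw [List.toFinset_card_of_nodup (List.nodup_range.filter _)]
      simp only [rank, List.range_succ, List.filter_append, List.length_append]
      simp [hnj]
    have hle : (((List.range (j + 1)).filter fun i => new i b).toFinset).card ≤ S.card := by
      refine Finset.card_le_card_of_injOn (fun i => (e b i).getD a) ?_ ?_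
      · intro i hi
        simp only [List.coe_toFinset, List.mem_filter, List.mem_range, decide_eq_true_eq,
          Set.mem_ofPred_eq] at hi
        obtain ⟨a', ha'⟩ := Option.isSome_iff_exists.1 hi.2.1
        simp only [ha', Option.getD_some]
        exact hS a' _ (e_sound b i a' ha')
      · intro i hi i' hi' h
        simp only [List.coe_toFinset, List.mem_filter, List.mem_range, decide_eq_true_eq,
          Set.mem_ofPred_eq] at hi hi'
        obtain ⟨a₁, ha₁⟩ := Option.isSome_iff_exists.1 hi.2.1
        obtain ⟨a₂, ha₂⟩ := Option.isSome_iff_exists.1 hi'.2.1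
        simp only [ha₁, ha₂, Option.getD_some] at h
        rcases lt_trichotomy i i' with hlt | heq | hgt
        · exact absurd (by rw [ha₁, ha₂, h]) (hi'.2.2 i (List.mem_range.2 hlt))
        · exact heq
        · exact absurd (by rw [ha₁, ha₂, h]) (hi.2.2 i' (List.mem_range.2 hgt))
    omega
  obtain ⟨p, hp, hpv⟩ := exists_bitsValue_eq hlt
  rw [← hp]
  refine hc p b a ?_
  have hfj : f (p, b) j = some a := by
    simp only [f, hpv]
    rw [if_pos ⟨hnj, trivial⟩, hj]
  have hdom : (Nat.rfindOpt (f (p, b))).Dom := Nat.rfindOpt_dom.2 ⟨j, a, hfj⟩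
  have hget := Part.get_mem hdom
  obtain ⟨i, hi⟩ := Nat.rfindOpt_spec hget
  have hi' : f (p, b) i = some ((Nat.rfindOpt (f (p, b))).get hdom) := hi
  have hij : i = j := by
    have h1 : new i b ∧ rank b i = rank b j := by
      simp only [f, hpv] at hi'
      split_ifs at hi' with h
      exact h
    rcases lt_trichotomy i j with hlt | heq | hgt
    · exact absurd h1.2 (rank_mono b i j hlt h1.1).ne
    · exact heq
    · exact absurd h1.2 (rank_mono b j i hgt hnj).ne'
  rw [hij, hfj] at hi'
  rw [Option.some.inj hi']
  exact hget

/-- With `K = C(x,y|e)`, consider the at most `2^(K+1)` pairs of complexity at most `K`, and let the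
fiber over `x` have about `2^s` elements. Then `y` is determined by `s + 1` bits inside this fiber.
At most `2^(K+1-s)` first coordinates have so large a fiber, so `x` costs `K + 1 - s` bits. The
number `s` cancels, and the logarithmic terms pay for `K` and `s`. -/
theorem exists_condC_nat_add_le (hU : IsOptimal U) : ∃ c : ℕ, ∀ x y e : ℕ,
    condC U x e + condC U y (e, x) ≤
      condC U (x, y) e + 9 * Nat.size (condC U (x, y) e) + c := by
  classical
  obtain ⟨M, hM, hMmono, hMU⟩ := hU.exists_stages_condC_le
  let R₁ : ((ℕ × ℕ) × ℕ) → ℕ → ℕ → Prop := fun b y k => M b.2 b.1.1 (Nat.pair b.1.2 y) k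
  have hR₁ : PrimrecPred fun t : (((ℕ × ℕ) × ℕ) × ℕ) × ℕ => R₁ t.1.1 t.1.2 t.2 := by
    have t1 : Primrec fun t : (((ℕ × ℕ) × ℕ) × ℕ) × ℕ => t.1.1 := Primrec.fst.comp Primrec.fst
    exact hM.comp ((((Primrec.snd.comp t1).pair (Primrec.fst.comp (Primrec.fst.comp t1))).pair
      (Primrec₂.natPair.comp (Primrec.snd.comp (Primrec.fst.comp t1))
        (Primrec.snd.comp Primrec.fst))).pair Primrec.snd)
  let Q : ℕ → (((ℕ × ℕ) × ℕ) × ℕ) × ℕ → Prop := fun y t =>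
    M t.1.1.1.2 t.1.1.1.1 (Nat.pair t.1.2 y) t.2
  have hQ : PrimrecRel Q := by
    have t1 : Primrec fun t : ℕ × (((ℕ × ℕ) × ℕ) × ℕ) × ℕ => t.2.1 :=
      Primrec.fst.comp Primrec.snd
    have t111 := Primrec.fst.comp (Primrec.fst.comp t1)
    exact hM.comp ((((Primrec.snd.comp t111).pair (Primrec.fst.comp t111)).pair
      (Primrec₂.natPair.comp (Primrec.snd.comp t1) Primrec.fst)).pair
        (Primrec.snd.comp Primrec.snd))
  -- A large fiber is recognized at a finite stage, once `2^s` of its elements have appeared.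
  let R₂ : ((ℕ × ℕ) × ℕ) → ℕ → ℕ → Prop := fun b x k =>
    2 ^ b.2 ≤ ((List.range k).filter fun y => Q y ((b, x), k)).length
  have hpow : Primrec fun n : ℕ => 2 ^ n := by
    have := Primrec.nat_rec₁ (f := fun _ n : ℕ => 2 * n) 1 (Primrec.nat_double.comp Primrec.snd)
    refine this.of_eq fun n => ?_
    induction n with
    | zero => rfl
    | succ n ih => rw [pow_succ', ← ih]
  have hR₂ : PrimrecPred fun t : (((ℕ × ℕ) × ℕ) × ℕ) × ℕ => R₂ t.1.1 t.1.2 t.2 :=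
    Primrec.nat_le.comp (hpow.comp (Primrec.snd.comp (Primrec.fst.comp Primrec.fst)))
      (Primrec.list_length.comp (hQ.listFilter.comp (Primrec.list_range.comp Primrec.snd)
        Primrec.id))
  obtain ⟨c₁, h₁⟩ := hU.exists_condC_le_of_enumeration hR₁
  obtain ⟨c₂, h₂⟩ := hU.exists_condC_le_of_enumeration hR₂
  obtain ⟨c₃, h₃⟩ := hU.exists_condC_le_condC_param (α := ℕ) (β := ℕ × ℕ)
  obtain ⟨c₄, h₄⟩ := hU.exists_condC_le_condC_param (α := ℕ) (β := ℕ)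
  refine ⟨c₁ + c₂ + c₃ + c₃ + c₄ + 5, fun x y e => ?_⟩
  set K := condC U (x, y) e with hK
  obtain ⟨S, hS, hScard⟩ := hU.exists_finset_condC_le (α := ℕ × ℕ) e K
  have hMS : ∀ x' y' k, M K e (Nat.pair x' y') k → (x', y') ∈ S := fun x' y' k h =>
    (hS _).2 ((hMU K e (Nat.pair x' y')).2 ⟨k, h⟩)
  have hSM : ∀ x' y', (x', y') ∈ S → ∃ k, M K e (Nat.pair x' y') k := fun x' y' h =>
    (hMU K e (Nat.pair x' y')).1 ((hS _).1 h)
  let fiber : ℕ → Finset ℕ := fun x' => (S.filter fun z => z.1 = x').image Prod.snd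
  have mem_fiber : ∀ x' y', y' ∈ fiber x' ↔ (x', y') ∈ S := by
    intro x' y'; simp [fiber]
  have hxy : (x, y) ∈ S := (hS _).2 le_rfl
  have hne : (fiber x).card ≠ 0 := Finset.card_ne_zero_of_mem ((mem_fiber x y).2 hxy)
  set s := Nat.log 2 (fiber x).card with hs
  have hs1 : 2 ^ s ≤ (fiber x).card := Nat.pow_log_le_self 2 hne
  have hs2 : (fiber x).card ≤ 2 ^ (s + 1) := (Nat.lt_pow_succ_log_self (by norm_num) _).le
  have hy : condC U y ((e, x), K) ≤ s + 1 + c₁ := by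
    obtain ⟨k, hk⟩ := hSM x y hxy
    exact h₁ ((e, x), K) (s + 1) (fiber x)
      (fun y' k h => (mem_fiber x y').2 (hMS x y' k h)) hs2 y k hk
  let S₂ : Finset ℕ := (S.image Prod.fst).filter fun x' => 2 ^ s ≤ (fiber x').card
  have hcount : S₂.card * 2 ^ s ≤ S.card := by
    have hdisj : (S₂.sigma fiber).card ≤ S.card := by
      refine Finset.card_le_card_of_injOn (fun p => (p.1, p.2)) ?_ ?_
      · rintro ⟨x', y'⟩ h
        exact (mem_fiber x' y').1 (Finset.mem_sigma.1 h).2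
      · rintro ⟨x', y'⟩ _ ⟨x'', y''⟩ _ h
        simpa using h
    rw [Finset.card_sigma] at hdisj
    refine le_trans ?_ hdisj
    rw [← smul_eq_mul]
    exact Finset.card_nsmul_le_sum _ _ _ fun x' h => (Finset.mem_filter.1 h).2
  have hR₂fiber : ∀ x' k, R₂ ((e, K), s) x' k → 2 ^ s ≤ (fiber x').card := by
    intro x' k h
    refine le_trans h ?_
    rw [← List.toFinset_card_of_nodup (List.nodup_range.filter _)]
    refine Finset.card_le_card fun y' hy' => ?_
    simp only [List.mem_toFinset, List.mem_filter, decide_eq_true_eq] at hy'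
    exact (mem_fiber x' y').2 (hMS x' y' k hy'.2)
  have hR₂x : ∃ k, R₂ ((e, K), s) x k := by
    choose! k hk using fun y' (h : y' ∈ fiber x) => hSM x y' ((mem_fiber x y').1 h)
    -- A stage late enough for every element of the fiber both to lie in the searched range and to
    -- be confirmed.
    let k₀ := (fiber x).sup fun y' => max (k y') (y' + 1)
    refine ⟨k₀, hs1.trans ?_⟩
    rw [← List.toFinset_card_of_nodup (List.nodup_range.filter _)]
    refine Finset.card_le_card fun y' hy' => ?_
    have hle : max (k y') (y' + 1) ≤ k₀ :=
      Finset.le_sup (f := fun y' => max (k y') (y' + 1)) hy'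
    simp only [List.mem_toFinset, List.mem_filter, decide_eq_true_eq, List.mem_range]
    exact ⟨lt_of_lt_of_le (Nat.lt_succ_self _) ((le_max_right _ _).trans hle),
      hMmono _ _ _ _ _ ((le_max_left _ _).trans hle) (hk y' hy')⟩
  have hsK : s ≤ K + 1 := by
    have hle : 2 ^ s ≤ 2 ^ (K + 1) := hs1.trans ((Finset.card_image_le.trans
      (Finset.card_filter_le _ _)).trans hScard)
    exact (Nat.pow_le_pow_iff_right (by norm_num)).1 hle
  have hx : condC U x ((e, K), s) ≤ (K + 1 - s) + c₂ := by
    obtain ⟨k, hk⟩ := hR₂x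
    refine h₂ ((e, K), s) (K + 1 - s) S₂ (fun x' k h => ?_) ?_ x k hk
    · have hcard := hR₂fiber x' k h
      refine Finset.mem_filter.2 ⟨?_, hcard⟩
      obtain ⟨y', hy'⟩ := Finset.card_pos.1 (lt_of_lt_of_le (by positivity) hcard)
      exact Finset.mem_image.2 ⟨(x', y'), (mem_fiber x' y').1 hy', rfl⟩
    · have h3 : S₂.card * 2 ^ s ≤ 2 ^ (K + 1 - s) * 2 ^ s := by
        rw [← pow_add, Nat.sub_add_cancel hsK]; exact hcount.trans hScard
      exact Nat.le_of_mul_le_mul_right h3 (by positivity)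
  -- Three parameters are removed, `K` twice and `s` once, at `3 * Nat.size` each; this gives the
  -- coefficient 9.
  have p₁ := h₃ y (e, x) K
  have p₂ := h₃ x (e, K) s
  have p₃ := h₄ x e K
  have hsize : Nat.size s ≤ Nat.size K + 1 := by
    rw [Nat.size_le]
    have := Nat.lt_size_self K
    rw [pow_succ]
    have := s.lt_two_pow_self
    omega
  omega

/-- The hard half of the chain rule (symmetry of information). -/
theorem exists_condC_add_le (hU : IsOptimal U) : ∃ c : ℕ, ∀ (a : α) (b : β) (e : γ),
    condC U a e + condC U b (e, a) ≤
      condC U (a, b) e + 9 * Nat.size (condC U (a, b) e) + c := by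
  obtain ⟨c, hc⟩ := hU.exists_condC_nat_add_le
  exact ⟨c, fun a b e => hc (Encodable.encode a) (Encodable.encode b) (Encodable.encode e)⟩

end IsOptimal

/-! ### Complexity of edges of the amplified graph -/

namespace BipGraph

theorem mem_amplify_E {α β : Type} [DecidableEq α] [DecidableEq β] {G : BipGraph α β} {m : ℕ}
    {x : α × List Bool} {y : β × List Bool} :
    (x, y) ∈ (G.amplify m).E ↔ (x.1, y.1) ∈ G.E ∧ x.2.length = m ∧ y.2.length = m := by
  simp only [amplify, Finset.mem_filter, Finset.mem_product, mem_bitStrings]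
  constructor
  · rintro ⟨⟨⟨-, h1⟩, -, h2⟩, h3⟩
    exact ⟨h3, h1, h2⟩
  · rintro ⟨h, h1, h2⟩
    have := Finset.mem_product.1 (G.E_subset h)
    exact ⟨⟨⟨this.1, h1⟩, this.2, h2⟩, h⟩

/-- The complexity of an edge between two sets of vertices of small complexity. -/
theorem exists_condC_edge_le {U : List Bool × ℕ →. ℕ} (hU : IsOptimal U)
    {A : ℕ × ℕ →. List (List Bool) × List (List Bool) × List (List Bool × List Bool)}
    (hA : Partrec A) :
    ∃ c : ℕ, ∀ (k d m a b s : ℕ) (w : List Bool) (G : BipGraph (List Bool) (List Bool))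
      (S T : Finset (List Bool × List Bool)), G.IsComputedBy A k d →
      (∀ x, x ∈ S ↔ condC U x w ≤ a) → (∀ y, y ∈ T ↔ condC U y w ≤ b) →
      ((G.amplify m).E.filter fun e => e.1 ∈ S ∧ e.2 ∈ T).card ≤ 2 ^ s →
      ∀ x ∈ S, ∀ y ∈ T, (x, y) ∈ (G.amplify m).E → condC U (x, y) w ≤
        s + 3 * (Nat.size k + Nat.size d + Nat.size m + Nat.size a + Nat.size b) + c := by
  obtain ⟨M, hM, hMmono, hMU⟩ := hU.exists_stages_condC_le
  obtain ⟨g, hg, hgA, hgmono⟩ := hA.exists_stages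
  let edges : ℕ → ℕ × ℕ → List (List Bool × List Bool) := fun t k =>
    ((g t k).map fun l => l.2.2).getD []
  have hedges : Primrec₂ edges :=
    Primrec.option_getD.comp (Primrec.option_map hg
      (Primrec.snd.comp (Primrec.snd.comp Primrec.snd))) (Primrec.const [])
  -- Stage `t` confirms an edge once short programs for both endpoints have halted and `A` has
  -- printed the underlying edge of `G`. The random parts only need length `m`.
  let R : ((((List Bool × ℕ) × ℕ) × ℕ) × ℕ) × ℕ →
      (List Bool × List Bool) × (List Bool × List Bool) → ℕ → Prop := fun p e t =>
    (M p.1.2 (Encodable.encode p.1.1.1.1.1) (Encodable.encode e.1) t ∧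
      M p.2 (Encodable.encode p.1.1.1.1.1) (Encodable.encode e.2) t) ∧
    (e.1.2.length = p.1.1.2 ∧ e.2.2.length = p.1.1.2) ∧
    ∃ z ∈ edges t (p.1.1.1.1.2, p.1.1.1.2), z = (e.1.1, e.2.1)
  have hR : PrimrecPred fun t : ((((((List Bool × ℕ) × ℕ) × ℕ) × ℕ) × ℕ) ×
      ((List Bool × List Bool) × (List Bool × List Bool))) × ℕ => R t.1.1 t.1.2 t.2 := by
    have q0 : Primrec fun t : ((((((List Bool × ℕ) × ℕ) × ℕ) × ℕ) × ℕ) ×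
      ((List Bool × List Bool) × (List Bool × List Bool))) × ℕ => t.1.1 :=
      Primrec.fst.comp Primrec.fst
    have q1 := Primrec.fst.comp q0
    have q2 := Primrec.fst.comp q1
    have q3 := Primrec.fst.comp q2
    have q4 := Primrec.fst.comp q3
    have hw := Primrec.encode.comp (Primrec.fst.comp q4)
    have e0 : Primrec fun t : ((((((List Bool × ℕ) × ℕ) × ℕ) × ℕ) × ℕ) ×
      ((List Bool × List Bool) × (List Bool × List Bool))) × ℕ => t.1.2 :=
      Primrec.snd.comp Primrec.fst
    have e1 := Primrec.fst.comp e0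
    have e2 := Primrec.snd.comp e0
    refine PrimrecPred.and (PrimrecPred.and ?_ ?_) (PrimrecPred.and (PrimrecPred.and ?_ ?_) ?_)
    · exact hM.comp ((((Primrec.snd.comp q1).pair hw).pair (Primrec.encode.comp e1)).pair
        Primrec.snd)
    · exact hM.comp ((((Primrec.snd.comp q0).pair hw).pair (Primrec.encode.comp e2)).pair
        Primrec.snd)
    · exact Primrec.eq.comp (Primrec.list_length.comp (Primrec.snd.comp e1)) (Primrec.snd.comp q2)
    · exact Primrec.eq.comp (Primrec.list_length.comp (Primrec.snd.comp e2)) (Primrec.snd.comp q2)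
    · exact (PrimrecRel.exists_mem_list Primrec.eq).comp
        (hedges.comp Primrec.snd ((Primrec.snd.comp q4).pair (Primrec.snd.comp q3)))
        ((Primrec.fst.comp e1).pair (Primrec.fst.comp e2))
  obtain ⟨c, hc⟩ := hU.exists_condC_le_of_enumeration hR
  obtain ⟨c₁, h₁⟩ := hU.exists_condC_le_condC_param
    (α := (List Bool × List Bool) × (List Bool × List Bool)) (β := List Bool)
  obtain ⟨c₂, h₂⟩ := hU.exists_condC_le_condC_param
    (α := (List Bool × List Bool) × (List Bool × List Bool)) (β := List Bool × ℕ)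
  obtain ⟨c₃, h₃⟩ := hU.exists_condC_le_condC_param
    (α := (List Bool × List Bool) × (List Bool × List Bool)) (β := (List Bool × ℕ) × ℕ)
  obtain ⟨c₄, h₄⟩ := hU.exists_condC_le_condC_param
    (α := (List Bool × List Bool) × (List Bool × List Bool)) (β := ((List Bool × ℕ) × ℕ) × ℕ)
  obtain ⟨c₅, h₅⟩ := hU.exists_condC_le_condC_param
    (α := (List Bool × List Bool) × (List Bool × List Bool))
    (β := (((List Bool × ℕ) × ℕ) × ℕ) × ℕ)
  refine ⟨c + c₁ + c₂ + c₃ + c₄ + c₅, fun k d m a b s w G S T hG hS hT hcard x hx y hy hxy => ?_⟩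
  obtain ⟨l, hl, -, -, hlE⟩ := hG
  have hedges_sound : ∀ t z, z ∈ edges t (k, d) → z ∈ G.E := by
    intro t z hz
    simp only [edges] at hz
    cases hgt : g t (k, d) with
    | none => simp [hgt] at hz
    | some l' =>
      have : l' = l := Part.mem_unique ((hgA _ _).2 ⟨t, hgt⟩) hl
      rw [← hlE, List.mem_toFinset, ← this]
      simpa [hgt] using hz
  have key : condC U (x, y) (((((w, k), d), m), a), b) ≤ s + c := by
    rw [mem_amplify_E] at hxy
    obtain ⟨t₁, ht₁⟩ := (hMU a (Encodable.encode w) (Encodable.encode x)).1 ((hS x).1 hx)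
    obtain ⟨t₂, ht₂⟩ := (hMU b (Encodable.encode w) (Encodable.encode y)).1 ((hT y).1 hy)
    obtain ⟨t₃, ht₃⟩ := (hgA _ _).1 hl
    refine hc (((((w, k), d), m), a), b) s _ ?_ hcard (x, y) (max t₁ (max t₂ t₃)) ⟨⟨?_, ?_⟩,
      ⟨hxy.2.1, hxy.2.2⟩, (x.1, y.1), ?_, rfl⟩
    · rintro ⟨x', y'⟩ t ⟨⟨hx', hy'⟩, ⟨hlx, hly⟩, z, hz, rfl⟩
      rw [Finset.mem_filter, mem_amplify_E]
      exact ⟨⟨hedges_sound t _ hz, hlx, hly⟩,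
        (hS x').2 ((hMU a (Encodable.encode w) (Encodable.encode x')).2 ⟨t, hx'⟩),
        (hT y').2 ((hMU b (Encodable.encode w) (Encodable.encode y')).2 ⟨t, hy'⟩)⟩
    · exact hMmono _ _ _ _ _ (le_max_left _ _) ht₁
    · exact hMmono _ _ _ _ _ ((le_max_left _ _).trans (le_max_right _ _)) ht₂
    · have := hgmono _ (max t₁ (max t₂ t₃)) _ _ ((le_max_right _ _).trans (le_max_right _ _)) ht₃
      simp only [edges, this, Option.map_some, Option.getD_some]
      rw [← List.mem_toFinset, hlE]
      exact hxy.1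
  have p₁ := h₁ (x, y) w k
  have p₂ := h₂ (x, y) (w, k) d
  have p₃ := h₃ (x, y) ((w, k), d) m
  have p₄ := h₄ (x, y) (((w, k), d), m) a
  have p₅ := h₅ (x, y) ((((w, k), d), m), a) b
  omega

/-- The complexity of an edge of the amplification of a good expander. -/
theorem exists_condC_edge_le_max {U : List Bool × ℕ →. ℕ} (hU : IsOptimal U)
    {A : ℕ × ℕ →. List (List Bool) × List (List Bool) × List (List Bool × List Bool)}
    (hA : Partrec A) :
    ∃ c : ℕ, ∀ (q d m : ℕ) (w : List Bool) (G : BipGraph (List Bool) (List Bool)), 2 ≤ q →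
      1 ≤ d → G.HasStandardParameters q d → G.IsComputedBy A (Nat.log 2 q) d →
      G.IsGoodSpectralExpander (q ^ d) q → ∀ x y, (x, y) ∈ (G.amplify m).E →
      (condC U (x, y) w : ℝ) ≤
        max (condC U x w + condC U y w - Real.logb 2 q)
          (m + d * Real.logb 2 q / 2 + (condC U x w + condC U y w) / 2) +
        3 * ((Nat.size (Nat.log 2 q) : ℝ) + Nat.size d + Nat.size m + Nat.size (condC U x w) +
          Nat.size (condC U y w)) + c := by
  obtain ⟨c, hc⟩ := exists_condC_edge_le hU hA
  refine ⟨c + 4, fun q d m w G hq hd hG hcomp hexp x y hxy => ?_⟩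
  set a := condC U x w
  set b := condC U y w
  set n := Real.logb 2 q
  obtain ⟨S, hS, hScard⟩ := hU.exists_finset_condC_le (α := List Bool × List Bool) w a
  obtain ⟨T, hT, hTcard⟩ := hU.exists_finset_condC_le (α := List Bool × List Bool) w b
  have hcard := card_amplify_edges_le (m := m) hq hd hG hexp S T
  have hq0 : (0 : ℝ) < q := by positivity
  have hqn : (2 : ℝ) ^ n = q := Real.rpow_logb (by norm_num) (by norm_num) hq0
  have hn0 : 0 ≤ n := Real.logb_nonneg (by norm_num) (by exact_mod_cast (by omega : 1 ≤ q))
  set μ := max ((a : ℝ) + b - n) (m + d * n / 2 + ((a : ℝ) + b) / 2) with hμ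
  have hμ0 : 0 ≤ μ := le_max_of_le_right (by positivity)
  have hST : (S.card : ℝ) * T.card ≤ 2 ^ ((a : ℝ) + b + 2) := by
    have e : (2 : ℝ) ^ ((a : ℝ) + b + 2) = 2 ^ (a + 1) * 2 ^ (b + 1) := by
      rw [← pow_add, ← Real.rpow_natCast]; congr 1; push_cast; ring
    rw [e]
    exact mul_le_mul (by exact_mod_cast hScard) (by exact_mod_cast hTcard) (Nat.cast_nonneg _)
      (by positivity)
  have t1 : (S.card : ℝ) * T.card / q ≤ 2 ^ (μ + 2) := by
    rw [div_le_iff₀ hq0]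
    refine hST.trans ?_
    rw [← hqn, ← Real.rpow_add (by norm_num)]
    refine Real.rpow_le_rpow_of_exponent_le (by norm_num) ?_
    have := le_max_left ((a : ℝ) + b - n) (m + d * n / 2 + ((a : ℝ) + b) / 2)
    linarith
  have sqrt_two : ∀ r : ℝ, √((2 : ℝ) ^ r) = 2 ^ (r / 2) := by
    intro r
    rw [Real.sqrt_eq_rpow, ← Real.rpow_mul (by norm_num)]; congr 1; ring
  have t2 : √((q : ℝ) ^ d) * 2 ^ m * √((S.card : ℝ) * T.card) ≤ 2 ^ (μ + 2) := by
    calc _ ≤ √((q : ℝ) ^ d) * 2 ^ m * √((2 : ℝ) ^ ((a : ℝ) + b + 2)) :=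
          mul_le_mul_of_nonneg_left (Real.sqrt_le_sqrt hST) (by positivity)
      _ = 2 ^ (n * d / 2 + m + ((a : ℝ) + b + 2) / 2) := by
          rw [← hqn, ← Real.rpow_natCast, ← Real.rpow_mul (by norm_num), sqrt_two, sqrt_two,
            ← Real.rpow_natCast, ← Real.rpow_add (by norm_num), ← Real.rpow_add (by norm_num)]
      _ ≤ _ := by
          refine Real.rpow_le_rpow_of_exponent_le (by norm_num) ?_
          have := le_max_right ((a : ℝ) + b - n) (m + d * n / 2 + ((a : ℝ) + b) / 2)
          linarith
  -- Each of the two terms of the mixing bound is at most `2^(μ+2)`, so their sum is at most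
  -- `2^(μ+3)`. Rounding up adds at most one more, whence the 4 in the constant.
  have hs : ((G.amplify m).E.filter fun e => e.1 ∈ S ∧ e.2 ∈ T).card ≤ 2 ^ ⌈μ + 3⌉₊ := by
    have h1 : (2 : ℝ) ^ (μ + 2) + 2 ^ (μ + 2) ≤ 2 ^ ⌈μ + 3⌉₊ := by
      have h2 : (2 : ℝ) ^ (μ + 2) + 2 ^ (μ + 2) = 2 ^ (μ + 3) := by
        rw [show μ + 3 = (μ + 2) + 1 by ring, Real.rpow_add_one (by norm_num)]; ring
      rw [h2, ← Real.rpow_natCast]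
      exact Real.rpow_le_rpow_of_exponent_le (by norm_num) (Nat.le_ceil _)
    have h3 := hcard.trans ((add_le_add t1 t2).trans h1)
    exact_mod_cast h3
  have key := hc (Nat.log 2 q) d m a b ⌈μ + 3⌉₊ w G S T hcomp hS hT hs x ((hS x).2 le_rfl) y
    ((hT y).2 le_rfl) hxy
  have hceil : (⌈μ + 3⌉₊ : ℝ) < μ + 3 + 1 := Nat.ceil_lt_add_one (by linarith)
  have key' : (condC U (x, y) w : ℝ) ≤ ⌈μ + 3⌉₊ + 3 * ((Nat.size (Nat.log 2 q) : ℝ) + Nat.size d +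
      Nat.size m + Nat.size a + Nat.size b) + c := by exact_mod_cast key
  push_cast
  linarith

end BipGraph

/-! ### Logarithmic error terms -/

theorem one_le_logTerm (N : ℕ) : 1 ≤ logTerm N := by
  rw [logTerm, Real.le_logb_iff_rpow_le (by norm_num) (by positivity), Real.rpow_one]
  linarith [Nat.cast_nonneg (α := ℝ) N]

theorem logTerm_mono {M N : ℕ} (h : M ≤ N) : logTerm M ≤ logTerm N := by
  have : (M : ℝ) ≤ N := by exact_mod_cast h
  exact Real.logb_le_logb_of_le (by norm_num) (by positivity) (by linarith)

theorem logTerm_le (N : ℕ) : logTerm N ≤ (N : ℝ) + 2 := by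
  have h : (0 : ℝ) < (N : ℝ) + 2 := by positivity
  rw [logTerm, Real.logb_le_iff_le_rpow (by norm_num) h]
  have h2 : N + 2 < 2 ^ (N + 2) := Nat.lt_two_pow_self
  have h3 : (N : ℝ) + 2 ≤ 2 ^ (N + 2) := by exact_mod_cast h2.le
  refine h3.trans (le_of_eq ?_)
  rw [← Real.rpow_natCast]; push_cast; rfl

/-- The binary length of a number that is at most linear in `N` is `O(log N)`. -/
theorem exists_size_le_logTerm (C : ℝ) : ∃ C' : ℝ, 0 ≤ C' ∧ ∀ j N : ℕ,
    (j : ℝ) ≤ C * ((N : ℝ) + 2) → (Nat.size j : ℝ) ≤ C' * logTerm N := by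
  set C₁ := max C 1 with hC₁
  have h1 : 1 ≤ C₁ := le_max_right _ _
  have hlog : 0 ≤ Real.logb 2 C₁ := Real.logb_nonneg (by norm_num) h1
  refine ⟨Real.logb 2 C₁ + 2, by linarith, fun j N h => ?_⟩
  have hL := one_le_logTerm N
  rcases Nat.eq_zero_or_pos j with rfl | hj
  · simp only [Nat.size_zero, Nat.cast_zero]
    positivity
  · have hpos : 0 < Nat.size j := Nat.size_pos.2 hj
    have hpow : 2 ^ (Nat.size j - 1) ≤ j := Nat.lt_size.1 (by omega)
    have hpow' : (2 : ℝ) ^ ((Nat.size j : ℝ) - 1) ≤ j := by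
      have : (2 : ℝ) ^ (Nat.size j - 1) ≤ j := by exact_mod_cast hpow
      rw [← Real.rpow_natCast, Nat.cast_sub hpos, Nat.cast_one] at this
      exact this
    have hN : (0 : ℝ) < (N : ℝ) + 2 := by positivity
    have h2 : (j : ℝ) ≤ C₁ * ((N : ℝ) + 2) :=
      h.trans (mul_le_mul_of_nonneg_right (le_max_left _ _) hN.le)
    have h3 : (Nat.size j : ℝ) - 1 ≤ Real.logb 2 (C₁ * ((N : ℝ) + 2)) :=
      (Real.le_logb_iff_rpow_le (by norm_num) (by positivity)).2 (hpow'.trans h2)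
    rw [Real.logb_mul (by positivity) hN.ne', ← logTerm] at h3
    nlinarith

/-- The relations between the complexities of two vertices and a string that hold up to a
logarithmic term. -/
theorem IsOptimal.exists_profile_bounds {U : List Bool × ℕ →. ℕ} (hU : IsOptimal U) :
    ∃ D : ℝ, 0 ≤ D ∧ ∀ (x y : List Bool × List Bool) (w : List Bool) (N : ℕ),
      N = vertexLength x + vertexLength y + w.length →
      ((plainC U (x, y) : ℝ) ≤ plainC U x + condC U y x + D * logTerm N ∧
        (plainC U (x, y) : ℝ) ≤ plainC U y + condC U x y + D * logTerm N) ∧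
      ((condC U x w : ℝ) + condC U y (w, x) ≤ condC U (x, y) w + D * logTerm N ∧
        (condC U y w : ℝ) + condC U x (w, y) ≤ condC U (x, y) w + D * logTerm N) ∧
      (condC U x (w, y) : ℝ) ≤ condC U x y + D * logTerm N ∧
      (condC U x w : ℝ) ≤ D * ((N : ℝ) + 2) ∧ (condC U y w : ℝ) ≤ D * ((N : ℝ) + 2) ∧
        (plainC U y : ℝ) ≤ D * ((N : ℝ) + 2) := by
  let V := List Bool × List Bool
  obtain ⟨c₁, vert⟩ := hU.exists_condC_vertex_le (β := List Bool)
  obtain ⟨c₂, vert'⟩ := hU.exists_condC_vertex_le (β := List Bool × V)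
  obtain ⟨c₃, chain⟩ := hU.exists_condC_le_add (α := V × V) (β := List Bool) (γ := V)
  obtain ⟨c₄, pairR⟩ := hU.exists_condC_comp_le (α := V) (β := List Bool × V)
    (f := fun y e => (e.2, y)) ((Computable.snd.comp Computable.snd).pair Computable.fst)
  obtain ⟨c₅, pairL⟩ := hU.exists_condC_comp_le (α := V) (β := List Bool × V)
    (f := fun x e => (x, e.2)) (Computable.fst.pair (Computable.snd.comp Computable.snd))
  obtain ⟨c₆, weaken⟩ := hU.exists_condC_le_condC_comp (α := V) (β := List Bool × V)
    Computable.snd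
  obtain ⟨c₇, hard⟩ := hU.exists_condC_add_le (α := V) (β := V) (γ := List Bool)
  obtain ⟨c₈, swap⟩ := hU.exists_condC_comp_le (α := V × V) (β := List Bool)
    (f := fun z _ => z.swap) ((Computable.snd.comp Computable.fst).pair
      (Computable.fst.comp Computable.fst))
  let C : ℝ := 9 + 3 * c₁ + c₂ + c₃ + c₄ + c₈
  have hC0 : 0 ≤ C := by positivity
  have hCe : ∀ {j N B : ℕ}, j ≤ 9 * N + B → (B : ℝ) ≤ C → (j : ℝ) ≤ C * ((N : ℝ) + 2) := by
    intro j N B hj hB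
    have h1 : (j : ℝ) ≤ 9 * N + B := by exact_mod_cast hj
    have hN : (0 : ℝ) ≤ N := Nat.cast_nonneg _
    have h9 : 9 ≤ C := by
      have : (0 : ℝ) ≤ 3 * c₁ + c₂ + c₃ + c₄ + c₈ := by positivity
      simp only [C]; linarith
    nlinarith
  obtain ⟨C', hC', size_le⟩ := exists_size_le_logTerm (4 * C)
  let D : ℝ := C + 9 * C' + c₃ + c₄ + c₅ + c₆ + c₇ + c₈
  refine ⟨D, by positivity, fun x y w N hN => ?_⟩
  have hL := one_le_logTerm N
  set L := logTerm N
  have absorb : ∀ (B : ℕ) (E : ℝ), (B : ℝ) + E ≤ D → 0 ≤ E → (B : ℝ) + E * L ≤ D * L := by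
    intro B E hE hE0
    have hB : (0 : ℝ) ≤ B := Nat.cast_nonneg _
    nlinarith
  have hc₁ : (c₁ : ℝ) ≤ C := by
    have : (0 : ℝ) ≤ 9 + 2 * c₁ + c₂ + c₃ + c₄ + c₈ := by positivity
    simp only [C]; linarith
  have ex : ∀ e : List Bool, condC U x e ≤ 9 * N + c₁ := fun e => by
    have := vert x e; omega
  have ey : ∀ e : List Bool, condC U y e ≤ 9 * N + c₁ := fun e => by
    have := vert y e; omega
  have sx : ∀ e : List Bool, (Nat.size (condC U x e) : ℝ) ≤ C' * L := fun e =>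
    size_le _ _ ((hCe (ex e) hc₁).trans (by nlinarith [Nat.cast_nonneg (α := ℝ) N]))
  have sy : ∀ e : List Bool, (Nat.size (condC U y e) : ℝ) ≤ C' * L := fun e =>
    size_le _ _ ((hCe (ey e) hc₁).trans (by nlinarith [Nat.cast_nonneg (α := ℝ) N]))
  -- Only a linear bound is wanted, so that `Nat.size` of this complexity is `O(log N)`. Bounding
  -- `Nat.size` by its argument turns `C(x|w) ≤ 3|x| + c₁` into the coefficient 9.
  have exy : condC U (x, y) w ≤ 9 * (N + N) + (3 * c₁ + c₂ + c₃ + c₄) := by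
    have h1 := chain (x, y) w x
    have h2 := pairR y (w, x)
    have h3 := vert' y (w, x)
    have h4 := vert x w
    have h5 := Nat.size_le_self (condC U x w)
    simp only [V] at h1 h2 h3 h4 h5
    omega
  have eyx : condC U (y, x) w ≤ 9 * (N + N) + (3 * c₁ + c₂ + c₃ + c₄ + c₈) := by
    have := swap (x, y) w
    simp only [Prod.swap_prod_mk] at this
    omega
  have sxy : (Nat.size (condC U (x, y) w) : ℝ) ≤ C' * L := by
    refine size_le _ _ ((hCe exy ?_).trans ?_)
    · have : (0 : ℝ) ≤ 9 + c₈ := by positivity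
      simp only [C]; push_cast; linarith
    · push_cast; nlinarith [Nat.cast_nonneg (α := ℝ) N]
  have syx : (Nat.size (condC U (y, x) w) : ℝ) ≤ C' * L := by
    refine size_le _ _ ((hCe eyx ?_).trans ?_)
    · simp only [C]; push_cast; linarith
    · push_cast; nlinarith [Nat.cast_nonneg (α := ℝ) N]
  have n₃ : (0 : ℝ) ≤ c₃ := Nat.cast_nonneg _
  have n₄ : (0 : ℝ) ≤ c₄ := Nat.cast_nonneg _
  have n₅ : (0 : ℝ) ≤ c₅ := Nat.cast_nonneg _
  have n₆ : (0 : ℝ) ≤ c₆ := Nat.cast_nonneg _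
  have n₇ : (0 : ℝ) ≤ c₇ := Nat.cast_nonneg _
  have n₈ : (0 : ℝ) ≤ c₈ := Nat.cast_nonneg _
  have hCD : C ≤ D := by simp only [D]; linarith
  have lin : ∀ j : ℕ, j ≤ 9 * N + c₁ → (j : ℝ) ≤ D * ((N : ℝ) + 2) := fun j hj =>
    (hCe hj hc₁).trans (mul_le_mul_of_nonneg_right hCD (by positivity))
  refine ⟨⟨?_, ?_⟩, ⟨?_, ?_⟩, ?_, lin _ (ex w), lin _ (ey w), lin _ (ey [])⟩
  · have h1 := chain (x, y) [] x
    have h2 := pairR y (([] : List Bool), x)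
    have h3 := weaken y (([] : List Bool), x)
    simp only at h2 h3
    have h4 : plainC U (x, y) ≤
        plainC U x + condC U y x + 2 * Nat.size (plainC U x) + (c₃ + c₄ + c₆) := by
      simp only [plainC]; omega
    have h5 : (plainC U (x, y) : ℝ) ≤
        plainC U x + condC U y x + 2 * Nat.size (plainC U x) + (c₃ + c₄ + c₆ : ℕ) := by
      exact_mod_cast h4
    have h6 : (Nat.size (plainC U x) : ℝ) ≤ C' * L := sx []
    have := absorb (c₃ + c₄ + c₆) (2 * C') (by simp only [D]; push_cast; linarith) (by positivity)
    linarith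
  · have h1 := chain (x, y) [] y
    have h2 := pairL x (([] : List Bool), y)
    have h3 := weaken x (([] : List Bool), y)
    simp only at h2 h3
    have h4 : plainC U (x, y) ≤
        plainC U y + condC U x y + 2 * Nat.size (plainC U y) + (c₃ + c₅ + c₆) := by
      simp only [plainC]; omega
    have h5 : (plainC U (x, y) : ℝ) ≤
        plainC U y + condC U x y + 2 * Nat.size (plainC U y) + (c₃ + c₅ + c₆ : ℕ) := by
      exact_mod_cast h4
    have h6 : (Nat.size (plainC U y) : ℝ) ≤ C' * L := sy []
    have := absorb (c₃ + c₅ + c₆) (2 * C') (by simp only [D]; push_cast; linarith) (by positivity)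
    linarith
  · have h1 : (condC U x w : ℝ) + condC U y (w, x) ≤
        condC U (x, y) w + 9 * Nat.size (condC U (x, y) w) + c₇ := by
      exact_mod_cast hard x y w
    have := absorb c₇ (9 * C') (by simp only [D]; linarith) (by positivity)
    linarith
  · have h0 := hard y x w
    have h2 := swap (x, y) w
    simp only [Prod.swap_prod_mk] at h2
    have h1 : (condC U y w : ℝ) + condC U x (w, y) ≤
        condC U (y, x) w + 9 * Nat.size (condC U (y, x) w) + c₇ := by
      exact_mod_cast h0
    have h3 : (condC U (y, x) w : ℝ) ≤ condC U (x, y) w + c₈ := by exact_mod_cast h2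
    have := absorb (c₇ + c₈) (9 * C') (by simp only [D]; push_cast; linarith) (by positivity)
    push_cast at this
    linarith
  · have h1 : (condC U x (w, y) : ℝ) ≤ condC U x y + c₆ := by exact_mod_cast weaken x (w, y)
    have := absorb c₆ 0 (by simp only [D]; linarith) le_rfl
    linarith

/-! ### The dichotomy for typical edges -/

theorem theorem2 (U : List Bool × ℕ →. ℕ) (hU : IsOptimal U)
    (A : ℕ × ℕ →. List (List Bool) × List (List Bool) × List (List Bool × List Bool))
    (hA : Partrec A) (c : ℝ) :
    ∃ c' : ℝ, ∀ (q d m : ℕ) (G : BipGraph (List Bool) (List Bool)),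
      1 ≤ d →
      G.HasStandardParameters q d →
      G.IsComputedBy A (Nat.log 2 q) d →
      G.IsGoodSpectralExpander (q ^ d) q →
      ∀ x y : List Bool × List Bool, (x, y) ∈ (G.amplify m).E →
        IsTypicalPair U c q d m x y →
        ∀ w : List Bool,
          |condMutualInfo U w y x|
              ≤ c * logTerm (vertexLength x + vertexLength y + w.length) →
          tripleInfo U w x y
              ≤ c' * logTerm (vertexLength x + vertexLength y + w.length) ∨
          Real.logb 2 q - c' * logTerm (vertexLength x + vertexLength y + w.length)
              ≤ condMutualInfo U w x y + condMutualInfo U w y x := by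
  obtain ⟨D, hD, profile⟩ := hU.exists_profile_bounds
  obtain ⟨c₁, edge⟩ := BipGraph.exists_condC_edge_le_max hU hA
  obtain ⟨C', hC', size_le⟩ := exists_size_le_logTerm (D + |c| + 1)
  set E : ℝ := 15 * C' + c₁ with hE
  have hE0 : 0 ≤ E := by positivity
  refine ⟨10 * (D + E + |c|), fun q d m G hd hG hcomp hexp x y hxy htyp w hw => ?_⟩
  obtain ⟨N, hN⟩ : ∃ N, N = vertexLength x + vertexLength y + w.length := ⟨_, rfl⟩
  obtain ⟨⟨P1, P2⟩, ⟨P3, P4⟩, P5, P6, P7, P8⟩ := profile x y w N hN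
  rw [← hN] at hw ⊢
  have hL := one_le_logTerm N
  have hLN := logTerm_le N
  have hLmono : logTerm (vertexLength x + vertexLength y) ≤ logTerm N :=
    logTerm_mono (by omega)
  have hL0 : 0 ≤ logTerm (vertexLength x + vertexLength y) :=
    zero_le_one.trans (one_le_logTerm _)
  have hc0 : 0 ≤ |c| := abs_nonneg c
  have hcc : c ≤ |c| := le_abs_self c
  have hcL : c * logTerm (vertexLength x + vertexLength y) ≤ |c| * logTerm N :=
    mul_le_mul hcc hLmono hL0 hc0
  obtain ⟨T1, T2, T3⟩ := htyp
  obtain ⟨-, T1⟩ := abs_le.1 (T1.trans hcL)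
  obtain ⟨T2', T2⟩ := abs_le.1 (T2.trans hcL)
  obtain ⟨T3', -⟩ := abs_le.1 (T3.trans hcL)
  obtain ⟨hw', -⟩ := abs_le.1 (hw.trans (mul_le_mul_of_nonneg_right hcc (by positivity)))
  set L := logTerm N
  have hDL : 0 ≤ D * L := by positivity
  have hEL : 0 ≤ E * L := by positivity
  have hcL0 : 0 ≤ |c| * L := by positivity
  -- For `q < 2` there is no spectral gap, but `n = 0`. It is enough that both conditional
  -- informations are nonnegative up to `O(log N)`: one by `P5`, the other by the hypothesis on `w`.
  rcases lt_or_ge q 2 with hq | hq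
  · right
    have hq0 : Real.logb 2 q = 0 := by
      interval_cases q <;> simp
    rw [hq0]
    simp only [condMutualInfo] at hw' ⊢
    linarith
  have hn1 : 1 ≤ Real.logb 2 q := by
    rw [Real.le_logb_iff_rpow_le (by norm_num) (by positivity), Real.rpow_one]
    exact_mod_cast hq
  have hlog : (Nat.log 2 q : ℝ) ≤ Real.logb 2 q := Real.natLog_le_logb q 2
  have hK := edge q d m w G hq hd hG hcomp hexp x y hxy
  set n := Real.logb 2 q
  have hd0 : (0 : ℝ) ≤ d := Nat.cast_nonneg d
  have hm0 : (0 : ℝ) ≤ m := Nat.cast_nonneg m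
  have hdn : (d : ℝ) ≤ d * n := le_mul_of_one_le_right hd0 hn1
  have hN2 : (0 : ℝ) < (N : ℝ) + 2 := by positivity
  have hcN : 0 ≤ |c| * ((N : ℝ) + 2) := by positivity
  -- Typicality of `y` bounds `(d+1)n + m` by `C(y)`, which is linear in `N`. So `d`, `m` and `log
  -- q` cost `O(log N)` bits as parameters.
  have hbound : d * n + n + m ≤ (D + |c| + 1) * ((N : ℝ) + 2) := by
    have : |c| * L ≤ |c| * ((N : ℝ) + 2) := mul_le_mul_of_nonneg_left hLN hc0
    linarith
  have small : ∀ {r : ℝ}, r ≤ D * ((N : ℝ) + 2) → r ≤ (D + |c| + 1) * ((N : ℝ) + 2) := by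
    intro r hr; linarith
  have s1 := size_le (Nat.log 2 q) N (by linarith)
  have s2 := size_le d N (by linarith)
  have s3 := size_le m N (by linarith)
  have s4 := size_le (condC U x w) N (small P6)
  have s5 := size_le (condC U y w) N (small P7)
  have hc₁ : (c₁ : ℝ) ≤ c₁ * L := le_mul_of_one_le_right (Nat.cast_nonneg _) hL
  have hK' : (condC U (x, y) w : ℝ) ≤
      max (condC U x w + condC U y w - n) (m + d * n / 2 + (condC U x w + condC U y w) / 2) +
        E * L := by
    have : E * L = 15 * (C' * L) + c₁ * L := by rw [hE]; ring
    linarith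
  simp only [tripleInfo, mutualInfo, condMutualInfo] at hw' ⊢
  rcases le_total (condC U x w + condC U y w - n)
    (m + d * n / 2 + ((condC U x w : ℝ) + condC U y w) / 2) with hle | hle
  -- Adding `P3` and `P4` cancels `C(x|w) + C(y|w)` against twice the bound `hK'`. `P1` and `P2`
  -- with typicality bound `C(y|x) + C(x|y)` from below.
  · right
    rw [max_eq_right hle] at hK'
    linarith
  -- `P4` and `hK'` give `C(x|w,y) ≤ C(x|w) - n`, while `P2` with typicality gives `C(x|y) ≥ n + m`,
  -- both up to `O(log N)`.
  · left
    rw [max_eq_left hle] at hK'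
    linarith
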